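/- **Setting.** Let $\Sigma$ be a surface with a pants decomposition: pairs of pants $P_1,\dots,P_k$, each with its boundary components labelled by the cyclically ordered labels $\infty,0,1$, and pants curves $\sigma_1,\dots,\sigma_\xi$, each of which is glued from two distinct such components, its two sides (no component is used twice; the remaining components are punctures). Let $c=(c_1,\dots,c_\xi)$ with all $c_i>0$. For half-lengths $a,b,d\ge 0$ put $$\kappa(a,b,d)=\frac{\cosh a\cosh b+\cosh d+\sqrt{\cosh^2a+\cosh^2b+\cosh^2d+2\cosh a\cosh b\cosh d-1}}{\cosh a+1},$$ $$A_\infty=\begin{pmatrix}\cosh a&\cosh a+1\\ \cosh a-1&\cosh a\end{pmatrix},\qquad A_0=\begin{pmatrix}\cosh b&-\sinh^2 b/\kappa\\ -\kappa&\cosh b\end{pmatrix},$$ let $A_1=(A_\infty A_0)^{-1}$, let $\Gamma(a,b,d)=\langle A_\infty,A_0\rangle$, and let $\mathbf P(a,b,d)=\mathbb H/\Gamma(a,b,d)$ be the standard three-holed sphere with $\partial_\infty,\partial_0,\partial_1$ of lengths $2a,2b,2d$ (length $0$ meaning a puncture) and with infinite area ends. Each $P_j$ is identified with the standard three-holed sphere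 whose half-lengths are $c_i$ for a side of $\sigma_i$ and $0$ for a puncture. For a component with label $\epsilon$, let $\Omega_\epsilon$ be the real Möbius map which conjugates the triple $(A_\infty,A_0,A_1)$, cyclically permuted so that $A_\epsilon$ comes first, to the triple $(A_\infty,A_0,A_1)$ of the three-holed sphere with half-lengths permuted in the same way (up to sign, i.e. in $\mathrm{PSL}(2,\mathbb R)$); it moves $\partial_\epsilon$ to $\partial_\infty$. **The $c$-gluing construction.** Let $\boldsymbol\mu=(\mu_1,\dots,\mu_\xi)$ with $\operatorname{Im}\mu_i\in[0,\pi)$. For a side of $\sigma_i$ with label $\epsilon$ write $c=c_i$, $\mu=\mu_i$, $r=\coth\frac c2$, $\theta=\frac{\operatorname{Im}\mu}2$. For $|s|<\frac\pi2$ let $h_s=\{z\in\mathbb H:|z+ir\tan s|=r\sec s\}$, a hypercycle around the axis of $A_\infty$, tending to the end of the three-holed sphere at $\partial_\infty$ as $s\to-\frac\pi2$. Fix widths $\nu>0$ on this side and $\nu^*>0$ on the other side of $\sigma_i$, with $\theta+\nu<\frac\pi2$ and $\theta+\nu^*<\frac\pi2$. The strip $H$ on this side is $\Omega_\epsilon^{-1}\bigl(\bigcup_{\theta-\nu^*<s<\theta+\nu}h_s\bigr)$;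 on the other side $\nu,\nu^*$ exchange roles. Assume that, for every side, $\Omega_\epsilon^{-1}\bigl(\bigcup_{-\pi/2<s<\theta+\nu}h_s\bigr)$ (the strip and everything beyond it) projects to the three-holed sphere injectively modulo the cyclic group of the boundary component, and that these embedded annuli are pairwise disjoint. Remove from the three-holed spheres the closed annuli which are the images of $\Omega_\epsilon^{-1}\bigl(\bigcup_{-\pi/2<s\le\theta-\nu^*}h_s\bigr)$, and glue across each $\sigma_i$ by identifying (the images of) $z\in H$ and $z'\in H'$, where $H,H'$ are the strips on its two sides with labels $\epsilon,\epsilon'$, whenever $\Omega_{\epsilon'}(z')=T_\mu J\,\Omega_\epsilon(z)$, with $$J=\begin{pmatrix}0&-\coth\frac c2\\ \tanh\frac c2&0\end{pmatrix},\qquad T_\mu=\begin{pmatrix}\cosh\frac\mu2&-\sinh\frac\mu2\coth\frac c2\\-\sinh\frac\mu2\tanh\frac c2&\cosh\frac\mu2\end{pmatrix}.$$ **The $c$-plumbing construction** with parameters $\mathbf t=(t_1,\dots,t_\xi)\in\mathbb C^\xi$. Let $\mathbb A_c=\{\zeta\in\mathbb C:e^{-\pi^2/c}<|\zeta|<1\}$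 with its complete hyperbolic metric of curvature $-1$. For each side of $\sigma_i$ one takes an open annular neighbourhood $U$ of the end of the three-holed sphere at that component and an injective, holomorphic, isometric local coordinate $\hat z:U\to\mathbb A_{c_i}$ such that $|\hat z|\to e^{-\pi^2/c_i}$ at the end, and which is real on the end segments in $U$ of the two seams at this component and positive on that of the outgoing one; here the outgoing and the incoming seam are the images of $\Omega_\epsilon^{-1}\{\operatorname{Re}z=0\}$ and $\Omega_\epsilon^{-1}\{|z-\frac{\cosh c_i}{\cosh c_i-1}|=\frac1{\cosh c_i-1}\}$. One also takes an open annulus $A\subset U$ and the closed annulus $B\subset U$ between $A$ and the end ($B$ being a neighbourhood of the end and $A\cup B$ open), the sets $A\cup B$ of different sides being disjoint. For the two sides of $\sigma_i$, with data $U,\hat z,A,B$ and $U',\hat z',A',B'$, there must be a holomorphic homeomorphism $f:A\to A'$ which maps the outer boundary $\partial B$ of $A$ to the inner boundary $\partial(A'\cup B')$ of $A'$ and satisfies $\hat z(x)\,\hat z'(f(x))=e^{i\pi t_i}$ for all $x\in A$. All the closed annuli $B$ are removed, and points $x\in U$, $y\in U'$ of the truncated surfaces on the two sides of $\sigma_i$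 are identified whenever $\hat z(x)\hat z'(y)=e^{i\pi t_i}$, for every $i$. **Proposition.** Whenever it can be carried out as above, the $c$-gluing construction with parameters $\boldsymbol\mu\in(\mathbb C_{[0,\pi)})^\xi$ is a $c$-plumbing construction with the parameters $\mathbf t$ given by $$t_i=\frac{i\pi-\mu_i}{c_i},\qquad i=1,\dots,\xi,$$ and $\mathbf t\in\mathbb H^\xi$, i.e. $\operatorname{Im}t_i>0$ for all $i$. That is, for a suitable choice of the data $U,\hat z,A,B,f$, the plumbing construction with parameters $\mathbf t$ has the same truncated surfaces and the same equivalence relation on them as the gluing construction, so that it yields the same surface with the same structure. -/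

import Mathlib

open Topology Filter
open scoped UpperHalfPlane MatrixGroups

noncomputable section

/-! ### The standard pairs of pants

The labels `∞, 0, 1` of the three boundary components of a pair of pants are the elements
`0, 1, 2` of `Fin 3`, in this (cyclic) order. A triple `L : Fin 3 → ℝ` prescribes the half-lengths:
`L 0, L 1, L 2` for the components `∂_∞, ∂_0, ∂_1`; half-length `0` means a puncture. -/

/-- Cyclic rotation of a triple of half-lengths, moving the component `e` to the position `∞`. -/
def rot (e : Fin 3) (L : Fin 3 → ℝ) : Fin 3 → ℝ := fun i => L (e + i)

/-- `coth (c / 2)`. -/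
def cothHalf (c : ℝ) : ℝ := Real.cosh (c / 2) / Real.sinh (c / 2)

/-- `tanh (c / 2)`. -/
def tanhHalf (c : ℝ) : ℝ := Real.sinh (c / 2) / Real.cosh (c / 2)

/-- With `c₁, c₂, c₃ = L 0, L 1, L 2`, this is `tanh (c₁/2) * coth (ν/2) * sinh c₂`, where `ν > 0`
is given by `coth ν = (cosh c₁ cosh c₂ + cosh c₃) / (sinh c₁ sinh c₂)`. It is written in the form
(obtained from `coth (ν/2) = coth ν + √(coth² ν - 1)`) which makes sense, by continuity, also when
some of the half-lengths vanish. -/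
def kap (L : Fin 3 → ℝ) : ℝ :=
  (Real.cosh (L 0) * Real.cosh (L 1) + Real.cosh (L 2) +
    √(Real.cosh (L 0) ^ 2 + Real.cosh (L 1) ^ 2 + Real.cosh (L 2) ^ 2 +
      2 * Real.cosh (L 0) * Real.cosh (L 1) * Real.cosh (L 2) - 1)) / (Real.cosh (L 0) + 1)

theorem kap_pos (L : Fin 3 → ℝ) : 0 < kap L := by
  have h0 := Real.cosh_pos (L 0)
  have h1 := Real.cosh_pos (L 1)
  have h2 := Real.cosh_pos (L 2)
  unfold kap
  positivity

/-- The generator `A_∞`, with axis from `- coth (c₁/2)` to `coth (c₁/2)` and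
translation length `2 c₁`. -/
def genInf (L : Fin 3 → ℝ) : SL(2, ℝ) :=
  ⟨!![Real.cosh (L 0), Real.cosh (L 0) + 1; Real.cosh (L 0) - 1, Real.cosh (L 0)], by
    rw [Matrix.det_fin_two_of]; ring⟩

/-- The generator `A_0`. Its entries are `cosh c₂`, `- coth (c₁/2) tanh (ν/2) sinh c₂`,
`- tanh (c₁/2) coth (ν/2) sinh c₂`, `cosh c₂`, with `ν` as in `kap`. -/
def genZero (L : Fin 3 → ℝ) : SL(2, ℝ) :=
  ⟨!![Real.cosh (L 1), -(Real.sinh (L 1) ^ 2 / kap L); -kap L, Real.cosh (L 1)], by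
    have h := (kap_pos L).ne'
    rw [Matrix.det_fin_two_of]
    field_simp
    linarith [Real.cosh_sq (L 1)]⟩

/-- The Fuchsian group `Γ(c₁, c₂, c₃) = ⟨A_∞, A_0, A_1 | A_∞ A_0 A_1 = Id⟩`, as a group of matrices
generated by `A_∞` and `A_0`. -/
def pantsGroup (L : Fin 3 → ℝ) : Subgroup SL(2, ℝ) :=
  Subgroup.closure {genInf L, genZero L}

/-- The standard three-holed sphere `P(c₁, c₂, c₃) = ℍ / Γ(c₁, c₂, c₃)`
(with its infinite area ends). -/
def Pants (L : Fin 3 → ℝ) : Type := Quotient (MulAction.orbitRel (pantsGroup L) ℍ)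

instance (L : Fin 3 → ℝ) : TopologicalSpace (Pants L) :=
  inferInstanceAs (TopologicalSpace (Quotient (MulAction.orbitRel (pantsGroup L) ℍ)))

/-- The quotient map `π : ℍ → P(c₁, c₂, c₃)`. -/
def Pants.proj (L : Fin 3 → ℝ) (z : ℍ) : Pants L :=
  Quotient.mk (MulAction.orbitRel (pantsGroup L) ℍ) z

/-- The quotient map `π`, as a function of a complex variable in the upper half-plane. -/
def Pants.projC (L : Fin 3 → ℝ) (w : ℂ) : Pants L :=
  Pants.proj L (UpperHalfPlane.ofComplex w)

/-- The Möbius map `Ω_0` which induces the isometry `P(c₁, c₂, c₃) → P(c₂, c₃, c₁)` moving `∂_0`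
to `∂_∞`, and which maps white hexagon to white hexagon;
`omegaZero_conj_genZero` and `omegaZero_conj_genOne` are its defining property. -/
def omegaZero (L : Fin 3 → ℝ) : GL (Fin 2) ℝ :=
  Matrix.GeneralLinearGroup.mkOfDetNeZero
    !![kap L, -(Real.cosh (L 1) + 1); kap L, -(Real.cosh (L 1) - 1)] (by
      rw [Matrix.det_fin_two_of]
      have h := kap_pos L
      nlinarith)

/-- `Ω_0` conjugates `A_0` to the `A_∞` of the rotated pair of pants. -/
theorem omegaZero_conj_genZero (L : Fin 3 → ℝ) :
    (omegaZero L : Matrix (Fin 2) (Fin 2) ℝ) * (genZero L : Matrix (Fin 2) (Fin 2) ℝ) =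
      (genInf (rot 1 L) : Matrix (Fin 2) (Fin 2) ℝ) * (omegaZero L : Matrix (Fin 2) (Fin 2) ℝ) := by
  have h := (kap_pos L).ne'
  have hs := Real.sinh_sq (L 1)
  simp only [omegaZero, genZero, genInf, rot, Matrix.GeneralLinearGroup.mkOfDetNeZero,
    Matrix.GeneralLinearGroup.mk', Matrix.unitOfDetInvertible_eq_nonsingInvUnit,
    Matrix.nonsingInvUnit]
  ext i j
  fin_cases i <;> fin_cases j <;> simp [Matrix.mul_apply, Fin.sum_univ_two, hs] <;> 
    field_simp <;> ring

/-- `Ω_0` conjugates `A_1 = (A_∞ A_0)⁻¹` to the `A_0` of the rotated pair of pants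
(up to the sign, which is trivial in `PSL(2, ℝ)`). -/
theorem omegaZero_conj_genOne (L : Fin 3 → ℝ) :
    (genZero (rot 1 L) : Matrix (Fin 2) (Fin 2) ℝ) * (omegaZero L : Matrix (Fin 2) (Fin 2) ℝ) *
        (genInf L : Matrix (Fin 2) (Fin 2) ℝ) * (genZero L : Matrix (Fin 2) (Fin 2) ℝ) =
      -(omegaZero L : Matrix (Fin 2) (Fin 2) ℝ) := by
  have hx : (omegaZero L : Matrix (Fin 2) (Fin 2) ℝ) = !![kap L, -(Real.cosh (L 1) + 1); kap L, -(Real.cosh (L 1) - 1)] := rfl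
  have h := kap_pos L
  have h' := kap_pos (rot 1 L)
  have hs := Real.sinh_sq (L 1)
  have hs2 := Real.sinh_sq (L 2)
  have ha := Real.one_le_cosh (L 0)
  have hb := Real.one_le_cosh (L 1)
  have hc := Real.one_le_cosh (L 2)
  obtain ⟨d, hd, hk, hk'⟩ : ∃ d : ℝ, d ^ 2 = Real.cosh (L 0) ^ 2 + Real.cosh (L 1) ^ 2 + Real.cosh (L 2) ^ 2 +
      2 * Real.cosh (L 0) * Real.cosh (L 1) * Real.cosh (L 2) - 1 ∧
      kap L * (Real.cosh (L 0) + 1) = Real.cosh (L 0) * Real.cosh (L 1) + Real.cosh (L 2) + d ∧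
      kap (rot 1 L) * (Real.cosh (L 1) + 1) = Real.cosh (L 1) * Real.cosh (L 2) + Real.cosh (L 0) + d := by
    refine ⟨_, Real.sq_sqrt (by nlinarith [mul_le_mul ha hb (by norm_num) (by linarith), mul_pos (mul_pos (Real.cosh_pos (L 0)) (Real.cosh_pos (L 1))) (Real.cosh_pos (L 2))]), ?_, ?_⟩
    · unfold kap; field_simp
    · unfold kap; simp only [rot, Fin.isValue]
      norm_num [show (1 : Fin 3) + 2 = 0 from rfl, show (1 : Fin 3) + 1 = 2 from rfl]
      field_simp
      ring_nf
  have hK : kap L ≠ 0 := h.ne'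
  have hcc : Real.cosh (L 2) = ((Real.cosh (L 0) + 1) * kap L ^ 2 -
      2 * Real.cosh (L 0) * Real.cosh (L 1) * kap L +
      (Real.cosh (L 0) - 1) * (Real.cosh (L 1) ^ 2 - 1)) / (2 * kap L) := by
    have h1 : Real.cosh (L 0) + 1 ≠ 0 := by linarith
    rw [eq_div_iff (by simpa using hK)]
    refine mul_left_cancel₀ h1 ?_
    have hd' : d = kap L * (Real.cosh (L 0) + 1) - Real.cosh (L 0) * Real.cosh (L 1) -
      Real.cosh (L 2) := by linarith
    rw [hd'] at hd
    linear_combination -hd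
  have hqq : 2 * kap L * kap (rot 1 L) = kap L ^ 2 * (Real.cosh (L 0) + 1) -
      2 * Real.cosh (L 0) * (Real.cosh (L 1) - 1) * kap L +
      (Real.cosh (L 0) - 1) * (Real.cosh (L 1) - 1) ^ 2 := by
    have h1 : Real.cosh (L 1) + 1 ≠ 0 := by linarith
    refine mul_left_cancel₀ h1 ?_
    rw [eq_div_iff (by simpa using hK)] at hcc
    linear_combination 2 * kap L * hk' - 2 * kap L * hk + (Real.cosh (L 1) - 1) * hcc
  have hX : (genZero (rot 1 L) : Matrix (Fin 2) (Fin 2) ℝ) = !![Real.cosh (L 2),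
      -((Real.cosh (L 2) ^ 2 - 1) / kap (rot 1 L)); -kap (rot 1 L), Real.cosh (L 2)] := by
    rw [← hs2]; rfl
  have hY : (genZero L : Matrix (Fin 2) (Fin 2) ℝ) = !![Real.cosh (L 1),
      -((Real.cosh (L 1) ^ 2 - 1) / kap L); -kap L, Real.cosh (L 1)] := by
    rw [← hs]; rfl
  have hZ : (genInf L : Matrix (Fin 2) (Fin 2) ℝ) =
    !![Real.cosh (L 0), Real.cosh (L 0) + 1; Real.cosh (L 0) - 1, Real.cosh (L 0)] := rfl
  have hW : (Real.cosh (L 2) ^ 2 - 1) / kap (rot 1 L) = ((Real.cosh (L 0) + 1) * kap L ^ 2 -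
      2 * Real.cosh (L 0) * (Real.cosh (L 1) + 1) * kap L +
      (Real.cosh (L 0) - 1) * (Real.cosh (L 1) + 1) ^ 2) / (2 * kap L) := by
    rw [div_eq_div_iff h'.ne' (by simpa using hK), hcc]
    field_simp
    linear_combination (-1) * ((Real.cosh (L 0) + 1) * kap L ^ 2 -
      2 * Real.cosh (L 0) * (Real.cosh (L 1) + 1) * kap L +
      (Real.cosh (L 0) - 1) * (Real.cosh (L 1) + 1) ^ 2) * hqq
  rw [hx, hX, hY, hZ, hW, hcc]
  clear hX hY hZ hx hW hs hs2 hk hk' hd hcc ha hb hc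
  generalize kap (rot 1 L) = q at *
  generalize kap L = K at *
  generalize Real.cosh (L 0) = a at *
  generalize Real.cosh (L 1) = b at *
  have hq' : q = (K ^ 2 * (a + 1) - 2 * a * (b - 1) * K + (a - 1) * (b - 1) ^ 2) / (2 * K) := by
    rw [eq_div_iff (by simpa using hK)]; linarith
  rw [hq']
  ext i j
  fin_cases i <;> fin_cases j <;>
    simp only [Matrix.mul_apply, Fin.sum_univ_two, Fin.zero_eta, Fin.mk_one, Matrix.of_apply,
      Matrix.cons_val', Matrix.cons_val_zero, Matrix.cons_val_one, Matrix.neg_apply,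
      Matrix.cons_val_fin_one] <;>
    field_simp <;> ring

/-- The normalizing map `Ω_e`, which moves the boundary component `e` of `P(L)` to the component
`∂_∞` of `P(rot e L)`: the identity for `∂_∞`, the map `Ω_0` above for `∂_0`, and for `∂_1` the
inverse of the map `Ω_0 : P(c₃, c₁, c₂) → P(c₁, c₂, c₃)`. -/
def omega (L : Fin 3 → ℝ) : Fin 3 → GL (Fin 2) ℝ :=
  ![1, omegaZero L, (omegaZero (rot 2 L))⁻¹]

/-- The hypercycle `|z + i r tan s| = r sec s`, `r = coth (c/2)`, around the axis of `A_∞` (which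
is the case `s = 0`). For `s` from `-π/2` to `π/2` the hypercycles sweep out `ℍ`, from the infinite
end of the pair of pants beyond the boundary geodesic (`s → -π/2`) towards its inside. -/
def hypercycle (c s : ℝ) : Set ℍ :=
  {z | ‖(z : ℂ) + Complex.I * ((cothHalf c * Real.tan s : ℝ) : ℂ)‖ = cothHalf c / Real.cos s}

/-- The union of the hypercycles with parameter in `T`. -/
def band (c : ℝ) (T : Set ℝ) : Set ℍ := {z | ∃ s ∈ T, z ∈ hypercycle c s}

/-- The hypercyclic region of `P(L)` around the boundary component `e`, with parameters in `T`. -/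
def Pants.region (L : Fin 3 → ℝ) (e : Fin 3) (T : Set ℝ) : Set (Pants L) :=
  {x | ∃ z : ℍ, omega L e • z ∈ band (L e) T ∧ Pants.proj L z = x}

/-- The filter of neighbourhoods of the infinite end of `P(L)` at the boundary component `e`. -/
def Pants.endFilter (L : Fin 3 → ℝ) (e : Fin 3) : Filter (Pants L) :=
  ⨅ s ∈ Set.Ioo (-(Real.pi / 2)) (Real.pi / 2),
    𝓟 (Pants.region L e (Set.Ioo (-(Real.pi / 2)) s))

/-! ### Pants decompositions -/

/-- A pants decomposition with `ξ` pants curves and `k` pairs of pants, the boundary components of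
each pair of pants being labelled by `∞, 0, 1`. The curve `i` has the two sides `(i, false)` and
`(i, true)`, and each side is a boundary component `(j, e)` of a pair of pants `j`; distinct sides
are distinct components. The remaining components are the punctures of the surface. -/
structure PantsDecomposition (k ξ : ℕ) where
  side : Fin ξ × Bool → Fin k × Fin 3
  side_injective : Function.Injective side

namespace PantsDecomposition

variable {k ξ : ℕ} (D : PantsDecomposition k ξ)

/-- The half-lengths of the pair of pants `j`: `c i` for a side of the curve `i`, and `0` for a
puncture. -/
def lengths (c : Fin ξ → ℝ) (j : Fin k) (e : Fin 3) : ℝ :=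
  Function.extend D.side (fun p => c p.1) (fun _ => 0) (j, e)

/-- The half-lengths of the pair of pants to which the side `p` belongs. -/
abbrev sideLengths (c : Fin ξ → ℝ) (p : Fin ξ × Bool) : Fin 3 → ℝ := D.lengths c (D.side p).1

/-- The label of the boundary component which is the side `p`. -/
abbrev label (p : Fin ξ × Bool) : Fin 3 := (D.side p).2

/-- The disjoint union of all the standard pairs of pants. -/
abbrev AllPants (c : Fin ξ → ℝ) : Type := Σ j : Fin k, Pants (D.lengths c j)

/-- A subset of the pair of pants of the side `p`, as a subset of the disjoint union. -/
def incl (c : Fin ξ → ℝ) (p : Fin ξ × Bool) (X : Set (Pants (D.sideLengths c p))) :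
    Set (D.AllPants c) :=
  Sigma.mk (D.side p).1 '' X

end PantsDecomposition

/-! ### The gluing construction -/

/-- The action of a complex `2 × 2` matrix on `ℂ` by the corresponding Möbius map. -/
def mob (A : Matrix (Fin 2) (Fin 2) ℂ) (z : ℂ) : ℂ :=
  (A 0 0 * z + A 0 1) / (A 1 0 * z + A 1 1)

/-- The matrix `J`, the rotation by `π` around `i coth (c/2)`. -/
def matJ (c : ℝ) : Matrix (Fin 2) (Fin 2) ℂ :=
  !![0, -(cothHalf c : ℂ); (tanhHalf c : ℂ), 0]

/-- The matrix `T_μ`, of complex translation length `μ` along the axis of `A_∞`. -/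
def matT (c : ℝ) (μ : ℂ) : Matrix (Fin 2) (Fin 2) ℂ :=
  !![Complex.cosh (μ / 2), -(Complex.sinh (μ / 2) * (cothHalf c : ℂ));
     -(Complex.sinh (μ / 2) * (tanhHalf c : ℂ)), Complex.cosh (μ / 2)]

namespace PantsDecomposition

variable {k ξ : ℕ} (D : PantsDecomposition k ξ)

/-- The parameters of the hypercycles in the strip `H` at the side `p`: the hypercycle `h` with
parameter `Im μ / 2` is thickened by `ν p` to the inside and, since the gluing map exchanges
inside and outside, by the `ν` of the opposite side to the outside. -/
def strip (μ : Fin ξ → ℂ) (ν : Fin ξ × Bool → ℝ) (p : Fin ξ × Bool) : Set ℝ :=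
  Set.Ioo ((μ p.1).im / 2 - ν (p.1, !p.2)) ((μ p.1).im / 2 + ν p)

/-- The parameters of the strip and of everything beyond it, up to the infinite end. -/
def collar (μ : Fin ξ → ℂ) (ν : Fin ξ × Bool → ℝ) (p : Fin ξ × Bool) : Set ℝ :=
  Set.Ioo (-(Real.pi / 2)) ((μ p.1).im / 2 + ν p)

/-- The parameters of what is cut off at the side `p`: everything beyond the strip, together with
the outer boundary of the strip. -/
def cutOff (μ : Fin ξ → ℂ) (ν : Fin ξ × Bool → ℝ) (p : Fin ξ × Bool) : Set ℝ :=
  Set.Ioc (-(Real.pi / 2)) ((μ p.1).im / 2 - ν (p.1, !p.2))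

/-- The conditions under which the gluing construction with parameters `μ` and strips of widths `ν`
can be carried out: at each side, the strip, together with the infinite part beyond it, projects to
an embedded annulus in the pair of pants (i.e. it injects modulo the cyclic group of the boundary
component), and these annuli are disjoint for different sides. -/
structure Admissible (c : Fin ξ → ℝ) (μ : Fin ξ → ℂ) (ν : Fin ξ × Bool → ℝ) : Prop where
  width_pos : ∀ p, 0 < ν p
  width_lt : ∀ p, (μ p.1).im / 2 + ν p < Real.pi / 2
  embedded : ∀ p, ∀ z w : ℍ,
    omega (D.sideLengths c p) (D.label p) • z ∈ band (c p.1) (collar μ ν p) →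
    omega (D.sideLengths c p) (D.label p) • w ∈ band (c p.1) (collar μ ν p) →
    Pants.proj (D.sideLengths c p) z = Pants.proj (D.sideLengths c p) w →
    ∃ n : ℤ, omega (D.sideLengths c p) (D.label p) • w =
      genInf (rot (D.label p) (D.sideLengths c p)) ^ n •
        (omega (D.sideLengths c p) (D.label p) • z)
  disjoint : ∀ p q, p ≠ q →
    Disjoint (D.incl c p (Pants.region (D.sideLengths c p) (D.label p) (collar μ ν p)))
      (D.incl c q (Pants.region (D.sideLengths c q) (D.label q) (collar μ ν q)))

/-- The disjoint union of the truncated surfaces `S_1, …, S_k`. -/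
def gluingTrunc (c : Fin ξ → ℝ) (μ : Fin ξ → ℂ) (ν : Fin ξ × Bool → ℝ) : Set (D.AllPants c) :=
  (⋃ p, D.incl c p (Pants.region (D.sideLengths c p) (D.label p) (cutOff μ ν p)))ᶜ

/-- The attaching map across the curve `i`: points `z`, `z'` of the strips on the two sides are
identified when `Ω_{e'} z' = T_μ J Ω_e z`. -/
def GluingRel (c : Fin ξ → ℝ) (μ : Fin ξ → ℂ) (ν : Fin ξ × Bool → ℝ) (x y : D.AllPants c) : Prop :=
  ∃ i : Fin ξ, ∃ z z' : ℍ,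
    x = ⟨_, Pants.proj (D.sideLengths c (i, false)) z⟩ ∧
    y = ⟨_, Pants.proj (D.sideLengths c (i, true)) z'⟩ ∧
    omega (D.sideLengths c (i, false)) (D.label (i, false)) • z ∈
      band (c i) (strip μ ν (i, false)) ∧
    omega (D.sideLengths c (i, true)) (D.label (i, true)) • z' ∈
      band (c i) (strip μ ν (i, true)) ∧
    ((omega (D.sideLengths c (i, true)) (D.label (i, true)) • z' : ℍ) : ℂ) =
      mob (matT (c i) (μ i)) (mob (matJ (c i))
        ((omega (D.sideLengths c (i, false)) (D.label (i, false)) • z : ℍ) : ℂ))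

/-- The equivalence relation of the gluing construction on the truncated surfaces; its quotient
is the surface `S(c, μ)`, with the structure induced from the truncated surfaces. -/
def gluingSetoid (c : Fin ξ → ℝ) (μ : Fin ξ → ℂ) (ν : Fin ξ × Bool → ℝ) :
    Setoid (D.gluingTrunc c μ ν) :=
  Relation.EqvGen.setoid fun x y => D.GluingRel c μ ν x.1 y.1

end PantsDecomposition

/-! ### The plumbing construction -/

/-- The annulus `A_c = {exp (-π²/c) < |ζ| < 1}`. -/
def annulusC (c : ℝ) : Set ℂ := {ζ | Real.exp (-(Real.pi ^ 2 / c)) < ‖ζ‖ ∧ ‖ζ‖ < 1}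

/-- The density of the complete hyperbolic metric (of curvature `-1`) of `A_c`. -/
def annulusDensity (c : ℝ) (ζ : ℂ) : ℝ :=
  c / (Real.pi * ‖ζ‖ * Real.sin (-(c / Real.pi * Real.log ‖ζ‖)))

/-- The seam `λ_1`: the imaginary axis, the outgoing seam at `∂_∞`. -/
def seamOut : Set ℍ := {z | z.re = 0}

/-- The seam `λ_0`: the half-circle `|z - C₁| = R₁` with `C₁ = cosh c / (cosh c - 1)` and
`R₁ = 1 / (cosh c - 1)`, the incoming seam at `∂_∞`. -/
def seamIn (c : ℝ) : Set ℍ :=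
  {z | ‖(z : ℂ) - ((Real.cosh c / (Real.cosh c - 1) : ℝ) : ℂ)‖ = 1 / (Real.cosh c - 1)}

/-- What the plumbing construction uses at the boundary component `e` of `P(L)`: an annular
neighbourhood `U` of the end, its local coordinate `coord : U → A_c` (`c = L e`), an annulus
`A ⊆ U`, and the closed annulus `B` between `A` and the end, which will be removed. -/
structure PlumbingEnd (L : Fin 3 → ℝ) (e : Fin 3) where
  U : Set (Pants L)
  isOpen_U : IsOpen U
  U_mem : U ∈ Pants.endFilter L e
  U_annulus : Nonempty (U ≃ₜ Circle × Set.Ioo (0 : ℝ) 1)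
  coord : Pants L → ℂ
  mapsTo : Set.MapsTo coord U (annulusC (L e))
  injOn : Set.InjOn coord U
  /-- `coord` is holomorphic and isometric for the hyperbolic metrics of `P(L)` and `A_c`. -/
  isometric : ∀ z : ℍ, Pants.proj L z ∈ U → ∃ d : ℂ,
    HasDerivAt (fun w => coord (Pants.projC L w)) d (z : ℂ) ∧
      annulusDensity (L e) (coord (Pants.proj L z)) * ‖d‖ = 1 / z.im
  /-- the infinite end corresponds to the inner boundary circle of `A_c` -/
  tendsto_end : Tendsto (fun x => ‖coord x‖) (Pants.endFilter L e)
    (𝓝 (Real.exp (-(Real.pi ^ 2 / L e))))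
  /-- a segment of the outgoing seam which runs in `U` to the end is mapped to positive numbers -/
  seam_out : ∀ s ∈ Set.Ioo (-(Real.pi / 2)) (Real.pi / 2),
    (∀ z : ℍ, omega L e • z ∈ seamOut ∩ band (L e) (Set.Ioo (-(Real.pi / 2)) s) →
      Pants.proj L z ∈ U) →
    ∀ z : ℍ, omega L e • z ∈ seamOut ∩ band (L e) (Set.Ioo (-(Real.pi / 2)) s) →
      ∃ a : ℝ, 0 < a ∧ coord (Pants.proj L z) = a
  /-- a segment of the incoming seam which runs in `U` to the end is mapped to real numbers -/
  seam_in : ∀ s ∈ Set.Ioo (-(Real.pi / 2)) (Real.pi / 2),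
    (∀ z : ℍ, omega L e • z ∈ seamIn (L e) ∩ band (L e) (Set.Ioo (-(Real.pi / 2)) s) →
      Pants.proj L z ∈ U) →
    ∀ z : ℍ, omega L e • z ∈ seamIn (L e) ∩ band (L e) (Set.Ioo (-(Real.pi / 2)) s) →
      ∃ a : ℝ, coord (Pants.proj L z) = a
  A : Set (Pants L)
  B : Set (Pants L)
  isOpen_A : IsOpen A
  A_annulus : Nonempty (A ≃ₜ Circle × Set.Ioo (0 : ℝ) 1)
  A_subset : A ⊆ U
  isClosed_B : IsClosed B
  B_annulus : Nonempty (B ≃ₜ Circle × Set.Ico (0 : ℝ) 1)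
  B_subset : B ⊆ U
  B_mem : B ∈ Pants.endFilter L e
  disjoint : Disjoint A B
  isOpen_union : IsOpen (A ∪ B)

/-- A homeomorphism `f` between open subsets of two pairs of pants is holomorphic: locally it lifts
to a holomorphic map between the upper half-planes. -/
def HolomorphicPants {L L' : Fin 3 → ℝ} (f : OpenPartialHomeomorph (Pants L) (Pants L')) : Prop :=
  ∀ z : ℍ, Pants.proj L z ∈ f.source → ∃ F : ℂ → ℂ, ∀ᶠ w in 𝓝 (z : ℂ),
    DifferentiableAt ℂ F w ∧ 0 < (F w).im ∧ f (Pants.projC L w) = Pants.projC L' (F w)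

/-- The existence of the map `f : A → A'` required for plumbing the ends `E` and `E'` with parameter
`t`: a holomorphic homeomorphism, carrying the outer boundary of `A` (the frontier of `B`) to the
inner boundary of `A'` (the frontier of `A' ∪ B'`), with `ẑ(x) ẑ'(f x) = exp(iπt)`. -/
def Plumbable {L L' : Fin 3 → ℝ} {e e' : Fin 3} (E : PlumbingEnd L e) (E' : PlumbingEnd L' e')
    (t : ℂ) : Prop :=
  ∃ f : OpenPartialHomeomorph (Pants L) (Pants L'), f.source = E.A ∧ f.target = E'.A ∧
    HolomorphicPants f ∧
    Tendsto f (𝓝ˢ (frontier E.B) ⊓ 𝓟 E.A) (𝓝ˢ (frontier (E'.A ∪ E'.B))) ∧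
    ∀ x ∈ E.A, E.coord x * E'.coord (f x) = Complex.exp (Complex.I * Real.pi * t)

namespace PantsDecomposition

variable {k ξ : ℕ} (D : PantsDecomposition k ξ)

/-- The relation `ẑ(x) ẑ'(y) = exp(iπt)` of the plumbing construction, for all pants curves. -/
def PlumbingRel (c : Fin ξ → ℝ) (E : ∀ p, PlumbingEnd (D.sideLengths c p) (D.label p))
    (t : Fin ξ → ℂ) (x y : D.AllPants c) : Prop :=
  ∃ i : Fin ξ, ∃ x' ∈ (E (i, false)).U, ∃ y' ∈ (E (i, true)).U,
    x = ⟨_, x'⟩ ∧ y = ⟨_, y'⟩ ∧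
    (E (i, false)).coord x' * (E (i, true)).coord y' = Complex.exp (Complex.I * Real.pi * t i)

/-- The quotient of the truncated pairs of pants `S` by the equivalence relation `r` is a surface
obtained by the `c`-plumbing construction with plumbing parameters `t`. -/
def IsPlumbing (c : Fin ξ → ℝ) (t : Fin ξ → ℂ) (S : Set (D.AllPants c)) (r : Setoid S) : Prop :=
  ∃ E : ∀ p, PlumbingEnd (D.sideLengths c p) (D.label p),
    (∀ p q, p ≠ q →
      Disjoint (D.incl c p ((E p).A ∪ (E p).B)) (D.incl c q ((E q).A ∪ (E q).B))) ∧
    (∀ i, Plumbable (E (i, false)) (E (i, true)) (t i)) ∧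
    S = (⋃ p, D.incl c p (E p).B)ᶜ ∧
    r = Relation.EqvGen.setoid fun x y => D.PlumbingRel c E t x.1 y.1

end PantsDecomposition

end

noncomputable section

/-! ### The axis coordinate on the upper half-plane -/

/-! At a boundary component put `w = Ω_e z`, `r = coth (c/2)` and use the logarithmic coordinate `X
= log ((w + r)/(r - w))`, which identifies `ℍ` with the strip `0 < Im X < π`. Everything in both
constructions becomes linear in `X`. The boundary deck transformation is `X ↦ X + 2c`
(`log_axisMap_genInf_smul`), the hypercycle `h_s` is the line `Im X = π/2 - s`
(`mem_hypercycle_iff`), the two seams are the lines `Re X = 0` and `Re X = c`, and the gluing map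
`T_μ J` is `X' = iπ - μ - X` (`log_axisMap_eq_iff`).

The plumbing coordinate is `ẑ = exp (iπX/c)`. It has period `2c`, so it descends to the embedded
collar. It is an isometry onto its image because the metric of the strip is `|dX| / sin (Im X)`, and
it is positive on `Re X = 0` and negative on `Re X = c`. From `X + X' = iπ - μ` one gets `ẑ ẑ' = exp
(iπ (iπ - μ)/c) = exp (iπt)`. Conversely, this product determines `X + X'` modulo `2c`, and a deck
transformation absorbs the ambiguity (`Admissible.gluingRel_iff`). Moreover `Im t = (π - Im μ)/c >
0`.

With `s` and `s'` the hypercycle parameters of the two points, the gluing map satisfies `s + s' = Im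
μ`. It therefore exchanges the inner and outer edges of the two strips. Hence `A` can be the strip,
`B` the part cut off and `U = A ∪ B`, with `f` given by `ζ ↦ a/ζ` in the coordinates `ẑ`
(`IsCollar.plumbable`).

What remains is topology in the quotient: `ẑ` is a chart, the regions are annuli
(`IsCollar.nonempty_region_homeomorph`), `B` is closed (`IsCollar.isClosed_region`), and `f` carries
boundary to boundary (`IsCollar.eventually_proj_cuffExp_mem`). -/

theorem cothHalf_pos {c : ℝ} (hc : 0 < c) : 0 < cothHalf c :=
  div_pos (Real.cosh_pos _) (Real.sinh_pos_iff.2 (by linarith))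

theorem tanhHalf_eq (c : ℝ) : tanhHalf c = (cothHalf c)⁻¹ := by
  simp [tanhHalf, cothHalf]

theorem cosh_sub_one_mul_cothHalf {c : ℝ} (hc : 0 < c) :
    (Real.cosh c - 1) * cothHalf c = Real.sinh c := by
  have hs : 0 < Real.sinh (c / 2) := Real.sinh_pos_iff.2 (by linarith)
  obtain ⟨x, rfl⟩ : ∃ x, c = 2 * x := ⟨c / 2, by ring⟩
  rw [show 2 * x / 2 = x by ring] at hs
  rw [cothHalf, show 2 * x / 2 = x by ring, Real.cosh_two_mul, Real.sinh_two_mul, Real.cosh_sq]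
  field_simp
  ring

theorem sinh_mul_cothHalf {c : ℝ} (hc : 0 < c) :
    Real.sinh c * cothHalf c = Real.cosh c + 1 := by
  have hs : 0 < Real.sinh (c / 2) := Real.sinh_pos_iff.2 (by linarith)
  obtain ⟨x, rfl⟩ : ∃ x, c = 2 * x := ⟨c / 2, by ring⟩
  rw [show 2 * x / 2 = x by ring] at hs
  rw [cothHalf, show 2 * x / 2 = x by ring, Real.cosh_two_mul, Real.sinh_two_mul, Real.sinh_sq]
  field_simp
  ring

/-- The Möbius map `w ↦ (w + r) / (r - w)`, `r = coth (c / 2)`, which sends the axis of `A_∞` to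
the imaginary axis. -/
def axisMap (c : ℝ) (hc : 0 < c) : GL (Fin 2) ℝ :=
  Matrix.GeneralLinearGroup.mkOfDetNeZero !![1, cothHalf c; -1, cothHalf c] (by
    rw [Matrix.det_fin_two_of]
    linarith [cothHalf_pos hc])

theorem coe_axisMap (c : ℝ) (hc : 0 < c) :
    (axisMap c hc : Matrix (Fin 2) (Fin 2) ℝ) = !![1, cothHalf c; -1, cothHalf c] := rfl

theorem det_axisMap_pos (c : ℝ) (hc : 0 < c) :
    0 < (axisMap c hc : Matrix (Fin 2) (Fin 2) ℝ).det := by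
  rw [coe_axisMap, Matrix.det_fin_two_of]
  linarith [cothHalf_pos hc]

theorem coe_axisMap_smul (c : ℝ) (hc : 0 < c) (w : ℍ) :
    ((axisMap c hc • w : ℍ) : ℂ) = ((w : ℂ) + cothHalf c) / (cothHalf c - w) := by
  rw [UpperHalfPlane.coe_smul_of_det_pos (det_axisMap_pos c hc)]
  simp only [UpperHalfPlane.num, UpperHalfPlane.denom, coe_axisMap]
  simp
  ring

theorem cothHalf_sub_coe_ne_zero (c : ℝ) (w : ℍ) : (cothHalf c : ℂ) - w ≠ 0 :=
  fun h => w.ne_ofReal _ (sub_eq_zero.1 h).symm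

theorem normSq_smul_axisMap_re (c : ℝ) (hc : 0 < c) (w : ℍ) :
    ((axisMap c hc • w : ℍ) : ℂ).re * Complex.normSq (cothHalf c - w) =
      cothHalf c ^ 2 - w.re ^ 2 - w.im ^ 2 := by
  have h : Complex.normSq (cothHalf c - w) ≠ 0 := by
    simpa using cothHalf_sub_coe_ne_zero c w
  rw [coe_axisMap_smul, Complex.div_re, ← add_div, div_mul_cancel₀ _ h]
  simp
  ring

theorem normSq_smul_axisMap_im (c : ℝ) (hc : 0 < c) (w : ℍ) :
    ((axisMap c hc • w : ℍ) : ℂ).im * Complex.normSq (cothHalf c - w) =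
      2 * cothHalf c * w.im := by
  have h : Complex.normSq (cothHalf c - w) ≠ 0 := by
    simpa using cothHalf_sub_coe_ne_zero c w
  rw [coe_axisMap_smul, Complex.div_im, ← sub_div, div_mul_cancel₀ _ h]
  simp
  ring

theorem arg_coe_mem_Ioo (u : ℍ) : Complex.arg u ∈ Set.Ioo 0 Real.pi := by
  have h : 0 < (u : ℂ).im := u.im_pos
  refine ⟨(Complex.arg_nonneg_iff.2 h.le).lt_of_ne' fun h0 => ?_,
    (Complex.arg_le_pi _).lt_of_ne fun h0 => ?_⟩
  · exact h.ne' (Complex.arg_eq_zero_iff.1 h0).2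
  · exact h.ne' (Complex.arg_eq_pi_iff.1 h0).2

/-- In polar form the right-hand side is `cos (arg u + s) = 0`. -/
theorem arg_eq_half_pi_sub_iff (u : ℍ) {s : ℝ} (hs : s ∈ Set.Ioo (-(Real.pi / 2)) (Real.pi / 2)) :
    Complex.arg u = Real.pi / 2 - s ↔ u.re * Real.cos s = u.im * Real.sin s := by
  have hn : ‖(u : ℂ)‖ ≠ 0 := by simpa using u.ne_zero
  have ha := arg_coe_mem_Ioo u
  rw [← UpperHalfPlane.coe_re, ← UpperHalfPlane.coe_im, ← Complex.norm_mul_cos_arg (u : ℂ),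
    ← Complex.norm_mul_sin_arg (u : ℂ), mul_assoc, mul_assoc, mul_right_inj' hn, ← sub_eq_zero,
    ← sub_eq_zero (b := Real.sin _ * _), ← Real.cos_add]
  constructor
  · intro h
    rw [sub_eq_zero.1 h, show Real.pi / 2 - s + s = Real.pi / 2 by ring, Real.cos_pi_div_two]
  · intro h
    obtain ⟨k, hk⟩ := Real.cos_eq_zero_iff.1 h
    have hpi := Real.pi_pos
    -- `arg u + s` lies in `(-π/2, 3π/2)`, where the only zero of the cosine is `π/2`.
    have h1 : (-1 : ℝ) < k := by
      by_contra! h1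
      nlinarith [ha.1, ha.2, hs.1, hs.2]
    have h2 : (k : ℝ) < 1 := by
      by_contra! h1
      nlinarith [ha.1, ha.2, hs.1, hs.2]
    have hk0 : k = 0 := by
      have : (-1 : ℤ) < k := by exact_mod_cast h1
      have : k < (1 : ℤ) := by exact_mod_cast h2
      omega
    subst hk0
    push_cast at hk
    linarith

/-- Hypercycles around the axis become rays from `0`, i.e. level sets of the argument. After
clearing denominators, both conditions read `(r² - |w|²) cos s = 2 r Im w sin s`. -/
theorem mem_hypercycle_iff {c : ℝ} (hc : 0 < c) {s : ℝ}
    (hs : s ∈ Set.Ioo (-(Real.pi / 2)) (Real.pi / 2)) (w : ℍ) :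
    w ∈ hypercycle c s ↔ Real.pi / 2 - Complex.arg (axisMap c hc • w : ℍ) = s := by
  have hr := cothHalf_pos hc
  have hcos : 0 < Real.cos s := Real.cos_pos_of_mem_Ioo hs
  have hN : 0 < Complex.normSq (cothHalf c - w) := by
    rw [Complex.normSq_pos]; exact cothHalf_sub_coe_ne_zero c w
  have hre := normSq_smul_axisMap_re c hc w
  have him := normSq_smul_axisMap_im c hc w
  have hs' : Real.pi / 2 - Complex.arg (axisMap c hc • w : ℍ) = s ↔
      Complex.arg (axisMap c hc • w : ℍ) = Real.pi / 2 - s := by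
    constructor <;> intro h <;> linarith
  rw [hs', arg_eq_half_pi_sub_iff _ hs, ← mul_left_inj' hN.ne', mul_right_comm,
    mul_right_comm _ (Real.sin s), ← UpperHalfPlane.coe_re, ← UpperHalfPlane.coe_im, hre, him]
  have hn : ‖(w : ℂ) + Complex.I * ((cothHalf c * Real.tan s : ℝ) : ℂ)‖ ^ 2 =
      w.re ^ 2 + (w.im + cothHalf c * Real.tan s) ^ 2 := by
    rw [← Complex.normSq_eq_norm_sq, Complex.normSq_apply]
    simp only [Complex.add_re, Complex.add_im, Complex.mul_re, Complex.mul_im, Complex.I_re,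
      Complex.I_im, Complex.ofReal_re, Complex.ofReal_im, UpperHalfPlane.coe_re,
      UpperHalfPlane.coe_im]
    ring
  have hsc := Real.sin_sq_add_cos_sq s
  rw [hypercycle, Set.mem_ofPred_eq, ← sq_eq_sq₀ (norm_nonneg _) (by positivity), hn,
    Real.tan_eq_sin_div_cos]
  constructor
  · intro h
    field_simp at h
    have : (Real.cos s) * ((cothHalf c ^ 2 - w.re ^ 2 - w.im ^ 2) * Real.cos s -
      2 * cothHalf c * w.im * Real.sin s) = 0 := by
      linear_combination -h + cothHalf c ^ 2 * hsc
    linarith [(mul_eq_zero.1 this).resolve_left hcos.ne']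
  · intro h
    field_simp
    linear_combination cothHalf c ^ 2 * hsc - Real.cos s * h

theorem mem_band_iff {c : ℝ} (hc : 0 < c) {T : Set ℝ}
    (hT : T ⊆ Set.Ioo (-(Real.pi / 2)) (Real.pi / 2)) (w : ℍ) :
    w ∈ band c T ↔ Real.pi / 2 - Complex.arg (axisMap c hc • w : ℍ) ∈ T := by
  constructor
  · rintro ⟨s, hs, hw⟩
    rwa [(mem_hypercycle_iff hc (hT hs) w).1 hw]
  · exact fun h => ⟨_, h, (mem_hypercycle_iff hc (hT h) w).2 rfl⟩

theorem mem_seamOut_iff {c : ℝ} (hc : 0 < c) (w : ℍ) :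
    w ∈ seamOut ↔ ‖((axisMap c hc • w : ℍ) : ℂ)‖ = 1 := by
  have hr := cothHalf_pos hc
  have hN : ‖(cothHalf c : ℂ) - w‖ ≠ 0 := by simpa using cothHalf_sub_coe_ne_zero c w
  rw [coe_axisMap_smul, norm_div, div_eq_one_iff_eq hN, ← sq_eq_sq₀ (norm_nonneg _) (norm_nonneg _),
    ← Complex.normSq_eq_norm_sq, ← Complex.normSq_eq_norm_sq, Complex.normSq_apply,
    Complex.normSq_apply]
  simp [seamOut]
  constructor
  · intro h; rw [h]; ring
  · intro h
    have : w.re * cothHalf c = 0 := by linarith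
    exact (mul_eq_zero.1 this).resolve_right hr.ne'

/-- The incoming seam is the Apollonius circle `|w + r| = e^c |r - w|` of the endpoints `±r` of the
axis. -/
theorem mem_seamIn_iff {c : ℝ} (hc : 0 < c) (w : ℍ) :
    w ∈ seamIn c ↔ ‖((axisMap c hc • w : ℍ) : ℂ)‖ = Real.exp c := by
  have hN : ‖(cothHalf c : ℂ) - w‖ ≠ 0 := by simpa using cothHalf_sub_coe_ne_zero c w
  have hch : 0 < Real.cosh c - 1 := by linarith [Real.one_lt_cosh.2 hc.ne']
  have e2 : Real.sinh c ^ 2 = Real.cosh c ^ 2 - 1 := Real.sinh_sq c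
  have hE : Real.exp c = Real.cosh c + Real.sinh c := (Real.cosh_add_sinh c).symm
  have hE1 : Real.exp c ^ 2 ≠ 1 := by
    have := Real.one_lt_exp_iff.2 hc
    nlinarith
  have hrr : cothHalf c = Real.sinh c / (Real.cosh c - 1) := by
    rw [eq_div_iff hch.ne', mul_comm]; exact cosh_sub_one_mul_cothHalf hc
  rw [seamIn, Set.mem_ofPred_eq, ← sq_eq_sq₀ (norm_nonneg _) (by positivity),
    ← Complex.normSq_eq_norm_sq, Complex.normSq_apply, coe_axisMap_smul, norm_div, div_eq_iff hN,
    ← sq_eq_sq₀ (norm_nonneg _) (by positivity), mul_pow, ← Complex.normSq_eq_norm_sq,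
    ← Complex.normSq_eq_norm_sq, Complex.normSq_apply, Complex.normSq_apply]
  simp only [Complex.sub_re, Complex.sub_im, Complex.add_re, Complex.add_im, Complex.ofReal_re,
    Complex.ofReal_im, UpperHalfPlane.coe_re, UpperHalfPlane.coe_im, sub_zero, add_zero, zero_sub]
  rw [hrr]
  rw [hE] at hE1 ⊢
  set C := Real.cosh c
  set S := Real.sinh c
  -- Both circle equations are multiples of the same quadratic expression; the second carries the
  -- extra factor `1 - e^(2c)`, which does not vanish.
  have h1 : (w.re - C / (C - 1)) * (w.re - C / (C - 1)) + w.im * w.im - (1 / (C - 1)) ^ 2 =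
      ((C - 1) * (w.re ^ 2 + w.im ^ 2) - 2 * C * w.re + (C + 1)) / (C - 1) := by
    field_simp
    ring
  have h2 : (w.re + S / (C - 1)) * (w.re + S / (C - 1)) + w.im * w.im -
      (C + S) ^ 2 * ((S / (C - 1) - w.re) * (S / (C - 1) - w.re) + -w.im * -w.im) =
      ((C - 1) * (w.re ^ 2 + w.im ^ 2) - 2 * C * w.re + (C + 1)) / (C - 1) *
        (1 - (C + S) ^ 2) := by
    have key : (w.re * (C - 1) + S) ^ 2 + w.im ^ 2 * (C - 1) ^ 2 =
        (C - 1) * ((C - 1) * (w.re ^ 2 + w.im ^ 2) - 2 * C * w.re + (C + 1)) +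
          2 * (C - 1) * w.re * (C + S) := by
      linear_combination e2
    have key2 : (S - w.re * (C - 1)) ^ 2 + w.im ^ 2 * (C - 1) ^ 2 =
        (C - 1) * ((C - 1) * (w.re ^ 2 + w.im ^ 2) - 2 * C * w.re + (C + 1)) +
          2 * (C - 1) * w.re * (C - S) := by
      linear_combination e2
    field_simp
    linear_combination key - (C + S) ^ 2 * key2 + 2 * (C - 1) * w.re * (C + S) * e2
  rw [← sub_eq_zero, h1, ← sub_eq_zero (b := (C + S) ^ 2 * _), h2,
    mul_eq_zero_iff_right (sub_ne_zero.2 hE1.symm)]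


/-! ### The logarithmic coordinate at a boundary component -/

theorem zpow_smul_eq_add {G X : Type*} [Group G] [MulAction G X] {f : X → ℂ} {g : G} {a : ℂ}
    (h : ∀ x, f (g • x) = f x + a) (n : ℤ) (x : X) : f (g ^ n • x) = f x + n * a := by
  have h' : ∀ x, f (g⁻¹ • x) = f x - a := fun x => by
    have := h (g⁻¹ • x)
    rw [smul_inv_smul] at this
    rw [this]; ring
  induction n generalizing x with
  | zero => simp
  | succ n ih =>
    rw [zpow_add_one, mul_smul, ih, h]
    push_cast; ring
  | pred n ih =>
    rw [zpow_sub_one, mul_smul, ih, h']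
    push_cast; ring

theorem sl_smul_eq (g : SL(2, ℝ)) (z : ℍ) :
    g • z = Matrix.SpecialLinearGroup.mapGL ℝ g • z := rfl

theorem coe_mapGL (g : SL(2, ℝ)) :
    (Matrix.SpecialLinearGroup.mapGL ℝ g : Matrix (Fin 2) (Fin 2) ℝ) = g := by
  ext i j; simp

/-- `axisMap` diagonalises `A_∞`, whose fixed points are `±r`: it becomes multiplication by
`e^(2c)`. A positive real factor leaves the argument alone, so the logarithm has no branch
ambiguity. -/
theorem log_axisMap_genInf_smul {c : ℝ} (hc : 0 < c) {L : Fin 3 → ℝ} (hL : L 0 = c) (w : ℍ) :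
    Complex.log (axisMap c hc • genInf L • w : ℍ) =
      Complex.log (axisMap c hc • w : ℍ) + 2 * c := by
  subst hL
  have h : ((axisMap (L 0) hc • genInf L • w : ℍ) : ℂ) =
      (Real.exp (2 * L 0) : ℝ) * (axisMap (L 0) hc • w : ℍ) := by
    rw [coe_axisMap_smul, coe_axisMap_smul]
    have hd := cothHalf_sub_coe_ne_zero (L 0) (genInf L • w)
    have hd' := cothHalf_sub_coe_ne_zero (L 0) w
    have hden : ((genInf L 1 0 : ℝ) : ℂ) * w + (genInf L 1 1 : ℝ) ≠ 0 := by
      have := UpperHalfPlane.denom_ne_zero (Matrix.SpecialLinearGroup.mapGL ℝ (genInf L)) w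
      simpa [UpperHalfPlane.denom] using this
    have hw := UpperHalfPlane.coe_specialLinearGroup_apply (genInf L) w
    simp only [Algebra.algebraMap_self, RingHom.id_apply] at hw
    have e00 : genInf L 0 0 = Real.cosh (L 0) := rfl
    have e01 : genInf L 0 1 = Real.cosh (L 0) + 1 := rfl
    have e10 : genInf L 1 0 = Real.cosh (L 0) - 1 := rfl
    have e11 : genInf L 1 1 = Real.cosh (L 0) := rfl
    rw [e10, e11] at hden
    rw [e00, e01, e10, e11] at hw
    rw [hw] at hd ⊢
    have h1 : (((Real.cosh (L 0) - 1) : ℝ) : ℂ) * (cothHalf (L 0) : ℝ) = (Real.sinh (L 0) : ℝ) := by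
      exact_mod_cast cosh_sub_one_mul_cothHalf hc
    have h2 : (Real.sinh (L 0) : ℂ) * (cothHalf (L 0) : ℝ) = (Real.cosh (L 0) + 1 : ℝ) := by
      exact_mod_cast sinh_mul_cothHalf hc
    have h3 : ((Real.exp (2 * L 0) : ℝ) : ℂ) * ((Real.cosh (L 0) : ℝ) - (Real.sinh (L 0) : ℝ)) =
        (Real.cosh (L 0) : ℝ) + (Real.sinh (L 0) : ℝ) := by
      norm_cast
      rw [Real.cosh_sub_sinh, Real.cosh_add_sinh, ← Real.exp_add]
      congr 1; ring
    rw [div_add' _ _ _ hden, ← mul_div_assoc, sub_div' hden]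
    rw [sub_div' hden] at hd
    have hd2 := left_ne_zero_of_mul (by rwa [div_eq_mul_inv] at hd)
    rw [div_div_div_cancel_right₀ hden, div_eq_div_iff hd2 hd']
    push_cast at *
    linear_combination (w + (cothHalf (L 0) : ℂ)) * (-(cothHalf (L 0) : ℂ) * h3 + h3 * w)
      + ((w : ℂ) * (cothHalf (L 0) - w) + w * Complex.exp (2 * L 0) * (-w - cothHalf (L 0))) * h1
      - (cothHalf (L 0) - w + Complex.exp (2 * L 0) * (w + cothHalf (L 0))) * h2
  rw [h, Complex.log_ofReal_mul (Real.exp_pos _) (UpperHalfPlane.ne_zero _), Real.log_exp]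
  push_cast; ring

theorem rot_rot (a b : Fin 3) (L : Fin 3 → ℝ) : rot a (rot b L) = rot (b + a) L := by
  ext i; simp [rot, add_assoc]

theorem rot_zero (L : Fin 3 → ℝ) : rot 0 L = L := by
  ext i; simp [rot]

theorem coe_omegaZero (L : Fin 3 → ℝ) : (omegaZero L : Matrix (Fin 2) (Fin 2) ℝ) =
    !![kap L, -(Real.cosh (L 1) + 1); kap L, -(Real.cosh (L 1) - 1)] := rfl

theorem det_omegaZero_pos (L : Fin 3 → ℝ) :
    0 < (omegaZero L : Matrix (Fin 2) (Fin 2) ℝ).det := by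
  rw [coe_omegaZero, Matrix.det_fin_two_of]
  linarith [kap_pos L]

theorem det_omega_pos (L : Fin 3 → ℝ) (e : Fin 3) :
    0 < (omega L e : Matrix (Fin 2) (Fin 2) ℝ).det := by
  fin_cases e
  · simp [omega]
  · exact det_omegaZero_pos L
  · change 0 < ((omegaZero (rot 2 L))⁻¹ : GL (Fin 2) ℝ).val.det
    have h := det_omegaZero_pos (rot 2 L)
    have := Matrix.GeneralLinearGroup.val_det_apply (omegaZero (rot 2 L))⁻¹
    rw [← this, map_inv, Units.val_inv_eq_inv_val]
    exact inv_pos.2 h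

theorem omegaZero_smul_genZero_smul (L : Fin 3 → ℝ) (z : ℍ) :
    omegaZero L • genZero L • z = genInf (rot 1 L) • omegaZero L • z := by
  rw [sl_smul_eq, sl_smul_eq, ← mul_smul, ← mul_smul]
  congr 1
  apply Units.ext
  simpa only [Units.val_mul, coe_mapGL] using omegaZero_conj_genZero L

theorem genZero_smul_omegaZero_smul (L : Fin 3 → ℝ) (z : ℍ) :
    genZero (rot 1 L) • omegaZero L • genInf L • genZero L • z = omegaZero L • z := by
  rw [sl_smul_eq, sl_smul_eq, sl_smul_eq, ← mul_smul, ← mul_smul, ← mul_smul,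
    ← UpperHalfPlane.neg_smul (omegaZero L)]
  congr 1
  apply Units.ext
  simpa only [Units.val_mul, Units.val_neg, coe_mapGL, mul_assoc] using omegaZero_conj_genOne L

/-- The deck transformation of the boundary component `e` is an element of the pants group. -/
theorem exists_omega_smul_eq (L : Fin 3 → ℝ) (e : Fin 3) : ∃ γ ∈ pantsGroup L, ∀ z : ℍ,
    omega L e • γ • z = genInf (rot e L) • omega L e • z := by
  have hInf : genInf L ∈ pantsGroup L := Subgroup.subset_closure (by simp)
  have hZero : genZero L ∈ pantsGroup L := Subgroup.subset_closure (by simp)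
  fin_cases e
  · exact ⟨genInf L, hInf, fun z => by simp [omega, rot_zero]⟩
  · exact ⟨genZero L, hZero, omegaZero_smul_genZero_smul L⟩
  · refine ⟨(genInf L * genZero L)⁻¹, inv_mem (mul_mem hInf hZero), fun z => ?_⟩
    change (omegaZero (rot 2 L))⁻¹ • _ = genInf (rot 2 L) • (omegaZero (rot 2 L))⁻¹ • z
    have h21 : rot 1 (rot 2 L) = L := by rw [rot_rot]; exact rot_zero L
    -- With `z` in this form, the two conjugation relations of the triple rotated by `2` apply
    -- directly; rotating that triple once more gives back `L`.
    obtain ⟨y, rfl⟩ : ∃ y, omegaZero (rot 2 L) • genZero (rot 2 L) • y = z :=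
      ⟨(genZero (rot 2 L))⁻¹ • (omegaZero (rot 2 L))⁻¹ • z, by simp⟩
    rw [inv_smul_eq_iff, inv_smul_smul, inv_smul_eq_iff, mul_smul]
    have h1 := omegaZero_smul_genZero_smul (rot 2 L) y
    have h2 := genZero_smul_omegaZero_smul (rot 2 L) y
    rw [h21] at h1 h2
    rw [h1, h2]

/-- The composition of `Ω_e` and of the map which sends the axis of `A_∞` to the imaginary axis. -/
def cuffMap (L : Fin 3 → ℝ) (e : Fin 3) (h : 0 < L e) : GL (Fin 2) ℝ := axisMap (L e) h * omega L e

theorem det_cuffMap_pos {L : Fin 3 → ℝ} {e : Fin 3} (h : 0 < L e) :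
    0 < (cuffMap L e h : Matrix (Fin 2) (Fin 2) ℝ).det := by
  rw [cuffMap, Units.val_mul, Matrix.det_mul]
  exact mul_pos (det_axisMap_pos _ _) (det_omega_pos _ _)

/-- The logarithmic coordinate at the boundary component `e`, with values in `{0 < Im < π}`, in
which the deck transformation is the translation by `2 * L e`. -/
def cuffLog (L : Fin 3 → ℝ) (e : Fin 3) (h : 0 < L e) (z : ℍ) : ℂ :=
  Complex.log (cuffMap L e h • z : ℍ)

/-- The parameter `s` of the hypercycle around the boundary component `e` on which `z` lies. -/
def cuffHeight (L : Fin 3 → ℝ) (e : Fin 3) (h : 0 < L e) (z : ℍ) : ℝ :=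
  Real.pi / 2 - (cuffLog L e h z).im

section

variable {L : Fin 3 → ℝ} {e : Fin 3} (h : 0 < L e)

theorem cuffLog_eq (z : ℍ) :
    cuffLog L e h z = Complex.log (axisMap (L e) h • omega L e • z : ℍ) := by
  rw [cuffLog, cuffMap, mul_smul]

theorem cuffLog_im (z : ℍ) : (cuffLog L e h z).im = Real.pi / 2 - cuffHeight L e h z := by
  rw [cuffHeight]; ring

theorem cuffHeight_mem (z : ℍ) :
    cuffHeight L e h z ∈ Set.Ioo (-(Real.pi / 2)) (Real.pi / 2) := by
  have := arg_coe_mem_Ioo (cuffMap L e h • z)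
  rw [← Complex.log_im] at this
  constructor <;> rw [cuffHeight, cuffLog] <;> linarith [this.1, this.2]

theorem mem_band_omega_iff {c : ℝ} (hc : L e = c) {T : Set ℝ}
    (hT : T ⊆ Set.Ioo (-(Real.pi / 2)) (Real.pi / 2)) (z : ℍ) :
    omega L e • z ∈ band c T ↔ cuffHeight L e h z ∈ T := by
  subst hc
  rw [mem_band_iff h hT, cuffHeight, cuffLog_eq, Complex.log_im]

theorem mem_region_iff {T : Set ℝ} (hT : T ⊆ Set.Ioo (-(Real.pi / 2)) (Real.pi / 2))
    (x : Pants L) : x ∈ Pants.region L e T ↔ ∃ z, cuffHeight L e h z ∈ T ∧ Pants.proj L z = x := by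
  simp only [Pants.region, Set.mem_ofPred_eq, mem_band_omega_iff h rfl hT]

theorem exp_cuffLog (z : ℍ) : Complex.exp (cuffLog L e h z) = (cuffMap L e h • z : ℍ) :=
  Complex.exp_log (UpperHalfPlane.ne_zero _)

theorem cuffLog_injective : Function.Injective (cuffLog L e h) := fun z w hzw => by
  have := congrArg Complex.exp hzw
  rw [exp_cuffLog, exp_cuffLog] at this
  exact MulAction.injective _ (UpperHalfPlane.coe_injective this)

theorem exists_cuffLog_eq {X : ℂ} (h0 : 0 < X.im) (hpi : X.im < Real.pi) :
    ∃ z, cuffLog L e h z = X := by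
  have him : 0 < (Complex.exp X).im := by
    rw [Complex.exp_im]
    exact mul_pos (Real.exp_pos _) (Real.sin_pos_of_pos_of_lt_pi h0 hpi)
  refine ⟨(cuffMap L e h)⁻¹ • ⟨_, him⟩, ?_⟩
  rw [cuffLog, smul_inv_smul, UpperHalfPlane.coe_mk,
    Complex.log_exp (by linarith) hpi.le]

theorem continuous_cuffLog : Continuous (cuffLog L e h) := by
  refine Continuous.clog (UpperHalfPlane.continuous_coe.comp (continuous_const_smul _)) fun z => ?_
  exact (cuffMap L e h • z).mem_slitPlane

theorem continuous_cuffHeight : Continuous (cuffHeight L e h) :=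
  continuous_const.sub (Complex.continuous_im.comp (continuous_cuffLog h))

/-- The inverse of the logarithmic coordinate. -/
def cuffExp (L : Fin 3 → ℝ) (e : Fin 3) (h : 0 < L e) (X : ℂ) : ℍ :=
  (cuffMap L e h)⁻¹ • UpperHalfPlane.ofComplex (Complex.exp X)

theorem cuffLog_cuffExp {X : ℂ} (h0 : 0 < X.im) (hpi : X.im < Real.pi) :
    cuffLog L e h (cuffExp L e h X) = X := by
  have him : 0 < (Complex.exp X).im := by
    rw [Complex.exp_im]
    exact mul_pos (Real.exp_pos _) (Real.sin_pos_of_pos_of_lt_pi h0 hpi)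
  rw [cuffLog, cuffExp, smul_inv_smul, UpperHalfPlane.ofComplex_apply_of_im_pos him,
    UpperHalfPlane.coe_mk, Complex.log_exp (by linarith) hpi.le]

theorem cuffExp_cuffLog (z : ℍ) : cuffExp L e h (cuffLog L e h z) = z := by
  rw [cuffExp, exp_cuffLog, UpperHalfPlane.ofComplex_apply, inv_smul_smul]

theorem differentiableAt_cuffExp {X : ℂ} (h0 : 0 < X.im) (hpi : X.im < Real.pi) :
    DifferentiableAt ℂ (fun X => (cuffExp L e h X : ℂ)) X := by
  have him : 0 < (Complex.exp X).im := by
    rw [Complex.exp_im]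
    exact mul_pos (Real.exp_pos _) (Real.sin_pos_of_pos_of_lt_pi h0 hpi)
  have hdet : 0 < ((cuffMap L e h)⁻¹ : GL (Fin 2) ℝ).val.det := by
    rw [← Matrix.GeneralLinearGroup.val_det_apply, map_inv, Units.val_inv_eq_inv_val]
    exact inv_pos.2 (det_cuffMap_pos h)
  have h1 := (UpperHalfPlane.hasStrictDerivAt_smul hdet ⟨_, him⟩).hasDerivAt.differentiableAt
  rw [UpperHalfPlane.coe_mk] at h1
  exact h1.comp X Complex.differentiable_exp.differentiableAt

theorem continuousAt_cuffExp {X : ℂ} (h0 : 0 < X.im) (hpi : X.im < Real.pi) :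
    ContinuousAt (cuffExp L e h) X := by
  rw [UpperHalfPlane.isEmbedding_coe.continuousAt_iff]
  exact (differentiableAt_cuffExp h h0 hpi).continuousAt

/-- The norm identity says that `cuffLog` is an isometry onto the strip with the metric `|dX| / sin
(Im X)`. -/
theorem hasStrictDerivAt_cuffLog (z : ℍ) : ∃ d : ℂ,
    HasStrictDerivAt (fun w => cuffLog L e h (UpperHalfPlane.ofComplex w)) d (z : ℂ) ∧
      ‖d‖ * z.im = Real.sin (cuffLog L e h z).im := by
  have h1 := UpperHalfPlane.hasStrictDerivAt_smul (det_cuffMap_pos h) z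
  set g := cuffMap L e h with hg
  have hu : ((g • UpperHalfPlane.ofComplex (z : ℂ) : ℍ) : ℂ) ∈ Complex.slitPlane :=
    UpperHalfPlane.mem_slitPlane _
  refine ⟨_, h1.clog hu, ?_⟩
  rw [UpperHalfPlane.ofComplex_apply, cuffLog, ← hg, Complex.log_im, norm_div, norm_div, norm_pow]
  have h2 := UpperHalfPlane.im_smul_eq_div_normSq g z
  have hn : ‖((g • z : ℍ) : ℂ)‖ ≠ 0 := by simpa using (g • z).ne_zero
  have h3 := Complex.norm_mul_sin_arg ((g • z : ℍ) : ℂ)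
  rw [UpperHalfPlane.coe_im, h2, Complex.normSq_eq_norm_sq] at h3
  rw [eq_comm, ← mul_right_inj' hn, h3, Complex.norm_real, Real.norm_eq_abs,
    Matrix.GeneralLinearGroup.val_det_apply]
  field_simp

theorem exists_deck (n : ℤ) : ∃ γ ∈ pantsGroup L, ∀ z : ℍ,
    cuffLog L e h (γ • z) = cuffLog L e h z + n * (2 * L e) := by
  obtain ⟨γ, hγ, hz⟩ := exists_omega_smul_eq L e
  refine ⟨γ ^ n, zpow_mem hγ n, fun z => zpow_smul_eq_add (fun w => ?_) n z⟩
  rw [cuffLog_eq, hz, log_axisMap_genInf_smul h (by simp [rot]), cuffLog_eq]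

theorem cuffLog_eq_of_omega_smul_eq {z w : ℍ} {n : ℤ}
    (hzw : omega L e • w = genInf (rot e L) ^ n • omega L e • z) :
    cuffLog L e h w = cuffLog L e h z + n * (2 * L e) := by
  rw [cuffLog_eq, cuffLog_eq, hzw]
  exact zpow_smul_eq_add (f := fun w : ℍ => Complex.log (axisMap (L e) h • w : ℍ))
    (log_axisMap_genInf_smul h (by simp [rot])) n _

/-! ### Hyperbolic distance controls the hypercycle parameter. -/

theorem UpperHalfPlane.dist_smul_of_det_pos {g : GL (Fin 2) ℝ} (hg : 0 < g.val.det) (z w : ℍ) :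
    dist (g • z) (g • w) = dist z w := by
  have hz := UpperHalfPlane.denom_ne_zero g z
  have hw := UpperHalfPlane.denom_ne_zero g w
  have hz' : ‖UpperHalfPlane.denom g z‖ ≠ 0 := by simp
  have hw' : ‖UpperHalfPlane.denom g w‖ ≠ 0 := by simp
  have hd : dist ((g • z : ℍ) : ℂ) (g • w : ℍ) =
      g.val.det * dist (z : ℂ) w / (‖UpperHalfPlane.denom g z‖ * ‖UpperHalfPlane.denom g w‖) := by
    rw [dist_eq_norm, dist_eq_norm, UpperHalfPlane.coe_smul_of_det_pos hg,
      UpperHalfPlane.coe_smul_of_det_pos hg, div_sub_div _ _ hz hw, norm_div, norm_mul]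
    congr 1
    rw [← abs_of_pos hg, ← Real.norm_eq_abs, ← Complex.norm_real, ← norm_mul, Matrix.det_fin_two]
    congr 1
    simp only [UpperHalfPlane.num, UpperHalfPlane.denom]
    push_cast
    ring
  have hcosh : Real.cosh (dist (g • z) (g • w)) = Real.cosh (dist z w) := by
    rw [UpperHalfPlane.cosh_dist, UpperHalfPlane.cosh_dist, hd,
      UpperHalfPlane.im_smul_eq_div_normSq, UpperHalfPlane.im_smul_eq_div_normSq,
      Complex.normSq_eq_norm_sq, Complex.normSq_eq_norm_sq,
      Matrix.GeneralLinearGroup.val_det_apply, abs_of_pos hg]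
    have := z.im_pos.ne'
    have := w.im_pos.ne'
    have := hg.ne'
    field_simp
  exact Real.cosh_strictMonoOn.injOn dist_nonneg dist_nonneg hcosh

/-- With moduli `a, b` and angle difference `φ`, `|u - v|² = (a - b)² + 2ab (1 - cos φ)`, whereas
`cosh d - 1 = |u - v|² / (2 Im u Im v)` and `Im u Im v ≤ ab`. -/
theorem UpperHalfPlane.one_sub_cos_arg_sub_le (u v : ℍ) :
    1 - Real.cos (Complex.arg u - Complex.arg v) ≤ Real.cosh (dist u v) - 1 := by
  have hu : 0 < ‖(u : ℂ)‖ := norm_pos_iff.2 u.ne_zero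
  have hv : 0 < ‖(v : ℂ)‖ := norm_pos_iff.2 v.ne_zero
  have hsu : 0 < Real.sin (Complex.arg u) :=
    Real.sin_pos_of_pos_of_lt_pi (arg_coe_mem_Ioo u).1 (arg_coe_mem_Ioo u).2
  have hsv : 0 < Real.sin (Complex.arg v) :=
    Real.sin_pos_of_pos_of_lt_pi (arg_coe_mem_Ioo v).1 (arg_coe_mem_Ioo v).2
  rw [UpperHalfPlane.cosh_dist, add_sub_cancel_left, dist_eq_norm, ← Complex.normSq_eq_norm_sq,
    Complex.normSq_apply, Complex.sub_re, Complex.sub_im, ← UpperHalfPlane.coe_im,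
    ← UpperHalfPlane.coe_im, ← Complex.norm_mul_cos_arg (u : ℂ), ← Complex.norm_mul_sin_arg (u : ℂ),
    ← Complex.norm_mul_cos_arg (v : ℂ), ← Complex.norm_mul_sin_arg (v : ℂ),
    le_div_iff₀ (by positivity), Real.cos_sub]
  have h1 := Real.sin_sq_add_cos_sq (Complex.arg u)
  have h2 := Real.sin_sq_add_cos_sq (Complex.arg v)
  set a := ‖(u : ℂ)‖
  set b := ‖(v : ℂ)‖
  set x := Real.cos (Complex.arg u)
  set y := Real.sin (Complex.arg u)
  set x' := Real.cos (Complex.arg v)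
  set y' := Real.sin (Complex.arg v)
  have hk : 0 ≤ 1 - (x * x' + y * y') := by nlinarith [sq_nonneg (x - x'), sq_nonneg (y - y')]
  have hyy : y * y' ≤ 1 := by nlinarith [sq_nonneg (y - y'), sq_nonneg x, sq_nonneg x']
  have e : (a * x - b * x') * (a * x - b * x') + (a * y - b * y') * (a * y - b * y') =
      (a - b) ^ 2 + 2 * (a * b) * (1 - (x * x' + y * y')) := by
    linear_combination a ^ 2 * h1 + b ^ 2 * h2
  rw [e]
  have : (1 - (x * x' + y * y')) * (2 * (a * b) * (y * y')) ≤
      (1 - (x * x' + y * y')) * (2 * (a * b) * 1) := by gcongr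
  nlinarith [sq_nonneg (a - b)]

/-- The point is that `δ` is uniform along the noncompact hypercycles, so it survives passing to
arbitrary translates under the pants group. -/
theorem exists_dist_lt_imp_cuffHeight_lt {a b : ℝ} (hab : a < b) (hpi : b - a ≤ Real.pi) :
    ∃ δ > 0, ∀ z w : ℍ, dist z w < δ → cuffHeight L e h w ≤ a → cuffHeight L e h z < b := by
  -- Any `δ` with `cosh x - 1 < 1 - cos (b - a)` for `|x| < δ` works: if the height rose from at
  -- most `a` to at least `b`, the angle difference would lie in `[b - a, π]`.
  have hcos : Real.cosh 0 < 2 - Real.cos (b - a) := by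
    have : Real.cos (b - a) < Real.cos 0 :=
      Real.cos_lt_cos_of_nonneg_of_le_pi le_rfl hpi (by linarith)
    rw [Real.cos_zero] at this
    rw [Real.cosh_zero]; linarith
  obtain ⟨δ, hδ, hball⟩ := Metric.eventually_nhds_iff.1
    (Real.continuous_cosh.continuousAt.eventually (gt_mem_nhds hcos))
  refine ⟨δ, hδ, fun z w hzw hw => ?_⟩
  by_contra! hz
  have h1 := UpperHalfPlane.one_sub_cos_arg_sub_le (cuffMap L e h • w) (cuffMap L e h • z)
  rw [UpperHalfPlane.dist_smul_of_det_pos (det_cuffMap_pos h), dist_comm, ← Complex.log_im,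
    ← Complex.log_im, ← cuffLog, ← cuffLog, cuffLog_im, cuffLog_im] at h1
  have h2 := @hball (dist z w) (by simpa using hzw)
  have h3 : Real.cos (Real.pi / 2 - cuffHeight L e h w - (Real.pi / 2 - cuffHeight L e h z)) ≤
      Real.cos (b - a) := by
    apply Real.cos_le_cos_of_nonneg_of_le_pi (by linarith) _ (by linarith)
    linarith [(cuffHeight_mem h w).1, (cuffHeight_mem h z).2]
  linarith

end

/-! ### The covering of the annulus -/

/-- The covering map `X ↦ exp (iπX/c)` from the strip `{0 < Im < π}` to the annulus `A_c`. -/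
def annulusExp (c : ℝ) (X : ℂ) : ℂ := Complex.exp (Complex.I * Real.pi / c * X)

/-- The radius of the circle in `A_c` which corresponds to the hypercycle with parameter `s`. -/
def annulusRadius (c s : ℝ) : ℝ := Real.exp (-(Real.pi * (Real.pi / 2 - s) / c))

theorem annulusExp_eq_iff {c : ℝ} (hc : 0 < c) (X Y : ℂ) :
    annulusExp c X = annulusExp c Y ↔ ∃ n : ℤ, X = Y + n * (2 * c) := by
  have hc' : (c : ℂ) ≠ 0 := by exact_mod_cast hc.ne'
  have hpi : (Real.pi : ℂ) ≠ 0 := by exact_mod_cast Real.pi_ne_zero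
  rw [annulusExp, annulusExp, Complex.exp_eq_exp_iff_exists_int]
  refine exists_congr fun n => ?_
  rw [← mul_right_inj' (mul_ne_zero Complex.I_ne_zero hpi)]
  field_simp

theorem norm_annulusExp (c : ℝ) (X : ℂ) :
    ‖annulusExp c X‖ = Real.exp (-(Real.pi * X.im / c)) := by
  rw [annulusExp, Complex.norm_exp,
    show Complex.I * Real.pi / c * X = ((Real.pi / c : ℝ) : ℂ) * (Complex.I * X) by push_cast; ring,
    Complex.re_ofReal_mul, Complex.I_mul_re]
  congr 1; ring

theorem annulusExp_ne_zero (c : ℝ) (X : ℂ) : annulusExp c X ≠ 0 := Complex.exp_ne_zero _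

theorem annulusRadius_strictMono {c : ℝ} (hc : 0 < c) : StrictMono (annulusRadius c) := by
  intro a b hab
  apply Real.exp_strictMono
  have := Real.pi_pos
  apply neg_lt_neg
  gcongr

theorem continuous_annulusRadius (c : ℝ) : Continuous (annulusRadius c) := by
  unfold annulusRadius
  fun_prop

theorem annulusRadius_neg_half_pi (c : ℝ) :
    annulusRadius c (-(Real.pi / 2)) = Real.exp (-(Real.pi ^ 2 / c)) := by
  rw [annulusRadius]; congr 2; ring

theorem annulusRadius_half_pi (c : ℝ) : annulusRadius c (Real.pi / 2) = 1 := by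
  simp [annulusRadius]

theorem hasStrictDerivAt_annulusExp (c : ℝ) (X : ℂ) :
    HasStrictDerivAt (annulusExp c) (annulusExp c X * (Complex.I * Real.pi / c)) X := by
  unfold annulusExp
  convert! ((hasStrictDerivAt_id X).const_mul (Complex.I * Real.pi / c)).cexp using 1
  simp

/-- The homeomorphism from the circle to the unit sphere of `ℂ`. -/
def circleHomeomorphSphere : Circle ≃ₜ Metric.sphere (0 : ℂ) 1 where
  toFun u := ⟨u, mem_sphere_zero_iff_norm.2 (Circle.norm_coe u)⟩
  invFun x := ⟨x, by simp [Submonoid.unitSphere]⟩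
  left_inv _ := rfl
  right_inv _ := rfl
  continuous_toFun := by fun_prop
  continuous_invFun := continuous_induced_rng.2 continuous_subtype_val

/-- Polar coordinates on the punctured plane, with a reparametrized radius; the model against which
all the annuli are compared. -/
theorem isEmbedding_polar {ρ : ℝ → ℝ} (hρ : ∀ y, 0 < ρ y) (hρ' : IsEmbedding ρ) :
    IsEmbedding fun p : Circle × ℝ => (ρ p.2 : ℂ) * (p.1 : ℂ) := by
  let g : ℝ → Set.Ioi (0 : ℝ) := fun y => ⟨ρ y, hρ y⟩
  have hg : IsEmbedding g := IsEmbedding.of_comp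
    (Continuous.subtype_mk hρ'.continuous _) continuous_subtype_val hρ'
  have h := IsEmbedding.subtypeVal.comp ((homeomorphUnitSphereProd ℂ).symm.isEmbedding.comp
    (circleHomeomorphSphere.isEmbedding.prodMap hg))
  convert! h using 1

theorem isEmbedding_annulusRadius {c : ℝ} (hc : 0 < c) : IsEmbedding (annulusRadius c) := by
  have hpi := Real.pi_ne_zero
  have hc' := hc.ne'
  have : annulusRadius c = ((↑) : Set.Ioi (0 : ℝ) → ℝ) ∘ Real.expOrderIso.toHomeomorph ∘
      affineHomeomorph (Real.pi / c) (-(Real.pi * (Real.pi / 2) / c)) (by positivity) := by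
    ext s
    simp only [annulusRadius, Function.comp_apply, OrderIso.coe_toHomeomorph,
      Real.coe_expOrderIso_apply, affineHomeomorph_apply]
    congr 1; ring
  rw [this]
  exact IsEmbedding.subtypeVal.comp
    ((Homeomorph.isEmbedding _).comp (Homeomorph.isEmbedding _))

/-! ### The quotient map to a pair of pants -/

section

variable {L : Fin 3 → ℝ}

theorem Pants.proj_eq_iff (z w : ℍ) :
    Pants.proj L z = Pants.proj L w ↔ ∃ γ ∈ pantsGroup L, γ • w = z := by
  refine (Quotient.eq (r := MulAction.orbitRel (pantsGroup L) ℍ)).trans ?_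
  rw [MulAction.orbitRel_apply, MulAction.mem_orbit_iff]
  exact ⟨fun ⟨γ, h⟩ => ⟨γ, γ.2, h⟩, fun ⟨γ, hγ, h⟩ => ⟨⟨γ, hγ⟩, h⟩⟩

theorem Pants.proj_smul {γ : SL(2, ℝ)} (hγ : γ ∈ pantsGroup L) (z : ℍ) :
    Pants.proj L (γ • z) = Pants.proj L z :=
  (Pants.proj_eq_iff _ _).2 ⟨γ, hγ, rfl⟩

theorem Pants.proj_surjective : Function.Surjective (Pants.proj L) := Quotient.mk_surjective

instance : Nonempty (Pants L) := ⟨Pants.proj L UpperHalfPlane.I⟩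

theorem Pants.continuous_proj : Continuous (Pants.proj L) := continuous_quot_mk

theorem Pants.isOpenMap_proj : IsOpenMap (Pants.proj L) :=
  isOpenMap_quotient_mk'_mul (Γ := pantsGroup L) (T := ℍ)

theorem Pants.map_proj_nhds (z : ℍ) : map (Pants.proj L) (𝓝 z) = 𝓝 (Pants.proj L z) :=
  Pants.isOpenMap_proj.map_nhds_eq Pants.continuous_proj.continuousAt

theorem Pants.projC_coe (z : ℍ) : Pants.projC L z = Pants.proj L z := by
  rw [Pants.projC, UpperHalfPlane.ofComplex_apply]

end

/-! ### Collars -/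

theorem UpperHalfPlane.map_ofComplex_nhds (z : ℍ) :
    map UpperHalfPlane.ofComplex (𝓝 (z : ℂ)) = 𝓝 z := by
  rw [← UpperHalfPlane.isOpenEmbedding_coe.map_nhds_eq, map_map]
  convert! map_id using 2
  ext1 w
  exact UpperHalfPlane.ofComplex_apply w

theorem UpperHalfPlane.exists_hasStrictDerivAt_smul {g : GL (Fin 2) ℝ} (hg : 0 < g.val.det)
    (z : ℍ) : ∃ d : ℂ,
      HasStrictDerivAt (fun w => ((g • UpperHalfPlane.ofComplex w : ℍ) : ℂ)) d (z : ℂ) ∧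
        ‖d‖ * z.im = (g • z).im := by
  refine ⟨_, UpperHalfPlane.hasStrictDerivAt_smul hg z, ?_⟩
  rw [UpperHalfPlane.im_smul_eq_div_normSq, Complex.normSq_eq_norm_sq, norm_div, norm_pow,
    Matrix.GeneralLinearGroup.val_det_apply, Complex.norm_real, Real.norm_eq_abs]
  ring

section

variable {L : Fin 3 → ℝ} {e : Fin 3} {h : 0 < L e}

theorem norm_annulusExp_cuffLog (z : ℍ) :
    ‖annulusExp (L e) (cuffLog L e h z)‖ = annulusRadius (L e) (cuffHeight L e h z) := by
  rw [norm_annulusExp, cuffLog_im, annulusRadius]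

theorem annulusExp_cuffLog_mem (z : ℍ) :
    annulusExp (L e) (cuffLog L e h z) ∈ annulusC (L e) := by
  have hz := cuffHeight_mem h z
  rw [annulusC, Set.mem_ofPred_eq, norm_annulusExp_cuffLog, ← annulusRadius_neg_half_pi,
    ← annulusRadius_half_pi (L e)]
  exact ⟨annulusRadius_strictMono h hz.1, annulusRadius_strictMono h hz.2⟩

/-- The derivative is nonzero, since its norm is a positive multiple of `sin (Im X) / Im z` and `0 <
Im X < π`. This gives continuity and openness at once. -/
theorem map_annulusExp_cuffLog_nhds (z : ℍ) :
    map (fun w => annulusExp (L e) (cuffLog L e h w)) (𝓝 z) =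
      𝓝 (annulusExp (L e) (cuffLog L e h z)) := by
  obtain ⟨d, hd, hd'⟩ := hasStrictDerivAt_cuffLog h z
  have hd0 : d ≠ 0 := by
    rintro rfl
    rw [norm_zero, zero_mul] at hd'
    have hm := cuffHeight_mem h z
    exact (Real.sin_pos_of_pos_of_lt_pi (by rw [cuffLog_im]; linarith [hm.2])
      (by rw [cuffLog_im]; linarith [hm.1])).ne hd'
  have hc' : (L e : ℂ) ≠ 0 := by exact_mod_cast h.ne'
  have hpi : (Real.pi : ℂ) ≠ 0 := by exact_mod_cast Real.pi_ne_zero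
  have h1 := hasStrictDerivAt_annulusExp (L e) (cuffLog L e h (UpperHalfPlane.ofComplex (z : ℂ)))
  have h2 := (h1.comp (z : ℂ) hd).map_nhds_eq (mul_ne_zero (mul_ne_zero (annulusExp_ne_zero _ _)
    (div_ne_zero (mul_ne_zero Complex.I_ne_zero hpi) hc')) hd0)
  rw [← UpperHalfPlane.map_ofComplex_nhds, map_map]
  simpa [Function.comp_def] using h2

/-- The part of parameters `< s₁` beyond a hypercycle projects to an embedded annulus. -/
structure IsCollar (L : Fin 3 → ℝ) (e : Fin 3) (h : 0 < L e) (s₁ : ℝ) : Prop where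
  lt : s₁ < Real.pi / 2
  embedded : ∀ z w : ℍ, cuffHeight L e h z < s₁ → cuffHeight L e h w < s₁ →
    Pants.proj L z = Pants.proj L w → ∃ n : ℤ, cuffLog L e h w = cuffLog L e h z + n * (2 * L e)

open Classical in
/-- The local coordinate with values in `A_c` on a collar. -/
def collarCoord (L : Fin 3 → ℝ) (e : Fin 3) (h : 0 < L e) (s₁ : ℝ) (x : Pants L) : ℂ :=
  if hx : ∃ z, cuffHeight L e h z < s₁ ∧ Pants.proj L z = x then
    annulusExp (L e) (cuffLog L e h hx.choose) else 0

theorem cuffHeight_eq_of_cuffLog_eq {z w : ℍ} {n : ℤ}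
    (hzw : cuffLog L e h w = cuffLog L e h z + n * (2 * L e)) :
    cuffHeight L e h w = cuffHeight L e h z := by
  rw [cuffHeight, hzw, cuffHeight]
  simp

/-- The converse of `IsCollar.embedded`, valid without any height restriction because translation by
`2 * L e` is realized in the pants group. -/
theorem exists_deck_of_cuffLog_eq {z w : ℍ} {n : ℤ}
    (hzw : cuffLog L e h w = cuffLog L e h z + n * (2 * L e)) :
    Pants.proj L w = Pants.proj L z := by
  obtain ⟨γ, hγ, hγz⟩ := exists_deck h n
  rw [show w = γ • z from cuffLog_injective h (by rw [hzw, hγz]), Pants.proj_smul hγ]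

theorem isOpen_region {T : Set ℝ} (hT : T ⊆ Set.Ioo (-(Real.pi / 2)) (Real.pi / 2))
    (hT' : IsOpen T) (h : 0 < L e) : IsOpen (Pants.region L e T) := by
  have : Pants.region L e T = Pants.proj L '' (cuffHeight L e h ⁻¹' T) := by
    ext x; rw [mem_region_iff h hT]; rfl
  rw [this]
  exact Pants.isOpenMap_proj _ (hT'.preimage (continuous_cuffHeight h))

theorem region_mono {T T' : Set ℝ} (hT : T ⊆ T') : Pants.region L e T ⊆ Pants.region L e T' :=
  fun _ ⟨z, ⟨s, hs, hz⟩, hx⟩ => ⟨z, ⟨s, hT hs, hz⟩, hx⟩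

theorem region_mem_endFilter {s : ℝ} (hs : s ∈ Set.Ioo (-(Real.pi / 2)) (Real.pi / 2)) :
    Pants.region L e (Set.Ioo (-(Real.pi / 2)) s) ∈ Pants.endFilter L e :=
  mem_iInf_of_mem s (mem_iInf_of_mem hs (mem_principal_self _))

end

/-- Adding `ε i` to the logarithmic coordinate lowers the height by `ε`. -/
theorem mem_closure_cuffHeight_lt {L : Fin 3 → ℝ} {e : Fin 3} (h : 0 < L e) (z : ℍ) :
    z ∈ closure {w | cuffHeight L e h w < cuffHeight L e h z} := by
  have hzim := cuffLog_im h z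
  have hm := cuffHeight_mem h z
  have ht : Tendsto (fun ε : ℝ => cuffExp L e h (cuffLog L e h z + ε * Complex.I)) (𝓝[>] 0)
      (𝓝 z) := by
    refine Tendsto.mono_left ?_ nhdsWithin_le_nhds
    have h1 : ContinuousAt (cuffExp L e h) (cuffLog L e h z + (0 : ℝ) * Complex.I) :=
      continuousAt_cuffExp h (by simp; linarith [hm.2]) (by simp; linarith [hm.1])
    have h2 : ContinuousAt (fun ε : ℝ => cuffLog L e h z + ε * Complex.I) 0 := by fun_prop
    have h3 := ContinuousAt.comp (f := fun ε : ℝ => cuffLog L e h z + ε * Complex.I) h1 h2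
    simpa [ContinuousAt, cuffExp_cuffLog, Function.comp_def] using h3
  refine mem_closure_of_tendsto ht ?_
  have e1 : ∀ᶠ ε : ℝ in 𝓝[>] 0, ε < Real.pi / 2 + cuffHeight L e h z :=
    mem_nhdsWithin_of_mem_nhds (gt_mem_nhds (by linarith [hm.1]))
  filter_upwards [e1, self_mem_nhdsWithin] with ε h1 h0
  have h0 : 0 < ε := h0
  rw [cuffHeight, cuffLog_cuffExp h (by simp; linarith [hm.2])
    (by simp; linarith)]
  simp
  linarith

/-! ### Coordinate, topology and boundary of an embedded collar. -/

namespace IsCollar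

variable {L : Fin 3 → ℝ} {e : Fin 3} {h : 0 < L e} {s₁ : ℝ} (hC : IsCollar L e h s₁)
include hC

theorem Ioo_subset :
    Set.Ioo (-(Real.pi / 2)) s₁ ⊆ Set.Ioo (-(Real.pi / 2)) (Real.pi / 2) :=
  Set.Ioo_subset_Ioo_right hC.lt.le

theorem mem_region_iff (x : Pants L) : x ∈ Pants.region L e (Set.Ioo (-(Real.pi / 2)) s₁) ↔
    ∃ z, cuffHeight L e h z < s₁ ∧ Pants.proj L z = x := by
  rw [_root_.mem_region_iff h hC.Ioo_subset]
  exact exists_congr fun z =>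
    and_congr_left' ⟨fun hz => hz.2, fun hz => ⟨(cuffHeight_mem h z).1, hz⟩⟩

/-- The lift chosen in `collarCoord` is immaterial: two lifts inside the collar differ by a multiple
of `2 * L e`, a period of `annulusExp`. -/
theorem coord_proj {z : ℍ} (hz : cuffHeight L e h z < s₁) :
    collarCoord L e h s₁ (Pants.proj L z) = annulusExp (L e) (cuffLog L e h z) := by
  have hx : ∃ w, cuffHeight L e h w < s₁ ∧ Pants.proj L w = Pants.proj L z := ⟨z, hz, rfl⟩
  rw [collarCoord, dif_pos hx, annulusExp_eq_iff h]
  exact hC.embedded _ _ hz hx.choose_spec.1 hx.choose_spec.2.symm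

theorem cuffHeight_eq {z w : ℍ} (hz : cuffHeight L e h z < s₁) (hw : cuffHeight L e h w < s₁)
    (hzw : Pants.proj L z = Pants.proj L w) : cuffHeight L e h w = cuffHeight L e h z := by
  obtain ⟨n, hn⟩ := hC.embedded z w hz hw hzw
  exact cuffHeight_eq_of_cuffLog_eq hn

/-- Inside an embedded collar the height is a function on the quotient, so regions can be tested on
any lift below `s₁`. -/
theorem proj_mem_region_iff {T : Set ℝ} (hT : T ⊆ Set.Ioo (-(Real.pi / 2)) s₁) {z : ℍ}
    (hz : cuffHeight L e h z < s₁) :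
    Pants.proj L z ∈ Pants.region L e T ↔ cuffHeight L e h z ∈ T := by
  rw [_root_.mem_region_iff h (hT.trans hC.Ioo_subset)]
  refine ⟨fun ⟨w, hw, hwz⟩ => ?_, fun hz => ⟨z, hz, rfl⟩⟩
  rwa [hC.cuffHeight_eq (hT hw).2 hz hwz]

theorem disjoint_region {T T' : Set ℝ} (hT : T ⊆ Set.Ioo (-(Real.pi / 2)) s₁)
    (hT' : T' ⊆ Set.Ioo (-(Real.pi / 2)) s₁) (hTT' : Disjoint T T') :
    Disjoint (Pants.region L e T) (Pants.region L e T') := by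
  rw [Set.disjoint_left] at hTT' ⊢
  intro x hx hx'
  obtain ⟨z, hz, rfl⟩ := (_root_.mem_region_iff h (hT.trans hC.Ioo_subset) x).1 hx
  exact hTT' hz ((hC.proj_mem_region_iff hT' (hT hz).2).1 hx')

theorem injOn_coord :
    Set.InjOn (collarCoord L e h s₁) (Pants.region L e (Set.Ioo (-(Real.pi / 2)) s₁)) := by
  intro x hx y hy hxy
  obtain ⟨z, hz, rfl⟩ := (hC.mem_region_iff x).1 hx
  obtain ⟨w, hw, rfl⟩ := (hC.mem_region_iff y).1 hy
  rw [hC.coord_proj hz, hC.coord_proj hw, annulusExp_eq_iff h] at hxy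
  obtain ⟨n, hn⟩ := hxy
  exact exists_deck_of_cuffLog_eq hn

theorem eventually_coord_proj {z : ℍ} (hz : cuffHeight L e h z < s₁) :
    (fun w => collarCoord L e h s₁ (Pants.proj L w)) =ᶠ[𝓝 z]
      fun w => annulusExp (L e) (cuffLog L e h w) :=
  ((continuous_cuffHeight h).continuousAt.eventually (gt_mem_nhds hz)).mono
    fun _ hw => hC.coord_proj hw

theorem map_coord_nhds {x : Pants L} (hx : x ∈ Pants.region L e (Set.Ioo (-(Real.pi / 2)) s₁)) :
    map (collarCoord L e h s₁) (𝓝 x) = 𝓝 (collarCoord L e h s₁ x) := by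
  obtain ⟨z, hz, rfl⟩ := (hC.mem_region_iff x).1 hx
  rw [← Pants.map_proj_nhds, map_map, hC.coord_proj hz, ← map_annulusExp_cuffLog_nhds]
  exact map_congr (hC.eventually_coord_proj hz)

theorem isOpen_region : IsOpen (Pants.region L e (Set.Ioo (-(Real.pi / 2)) s₁)) :=
  _root_.isOpen_region hC.Ioo_subset isOpen_Ioo h

theorem isOpenMap_domRestrict_coord :
    IsOpenMap ((Pants.region L e (Set.Ioo (-(Real.pi / 2)) s₁)).domRestrict
      (collarCoord L e h s₁)) := by
  refine IsOpenMap.of_nhds_le fun x => ?_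
  have h1 := hC.map_coord_nhds x.2
  rw [← hC.isOpen_region.nhdsWithin_eq x.2, ← map_nhds_subtype_val, map_map] at h1
  exact h1.ge

/-- The local coordinate of a collar, as a chart of the pair of pants. -/
def chart : OpenPartialHomeomorph (Pants L) ℂ :=
  OpenPartialHomeomorph.ofContinuousOpenRestrict
    (hC.injOn_coord.toPartialEquiv (collarCoord L e h s₁)
      (Pants.region L e (Set.Ioo (-(Real.pi / 2)) s₁)))
    (fun _ hx => ContinuousAt.continuousWithinAt (hC.map_coord_nhds hx).le)
    hC.isOpenMap_domRestrict_coord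
    hC.isOpen_region

theorem coe_chart : ⇑hC.chart = collarCoord L e h s₁ := rfl

theorem isEmbedding_domRestrict_coord {T : Set ℝ} (hT : T ⊆ Set.Ioo (-(Real.pi / 2)) s₁) :
    IsEmbedding ((Pants.region L e T).domRestrict (collarCoord L e h s₁)) := by
  have h1 : IsEmbedding ((Pants.region L e (Set.Ioo (-(Real.pi / 2)) s₁)).domRestrict
      (collarCoord L e h s₁)) := hC.chart.isOpenEmbedding_restrict.isEmbedding
  exact h1.comp (IsEmbedding.inclusion (region_mono hT))

theorem image_coord {T : Set ℝ} (hT : T ⊆ Set.Ioo (-(Real.pi / 2)) s₁) :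
    collarCoord L e h s₁ '' Pants.region L e T = {ζ | ∃ s ∈ T, ‖ζ‖ = annulusRadius (L e) s} := by
  ext ζ
  constructor
  · rintro ⟨x, hx, rfl⟩
    obtain ⟨z, hz, rfl⟩ := (_root_.mem_region_iff h (hT.trans hC.Ioo_subset) x).1 hx
    exact ⟨_, hz, by rw [hC.coord_proj (hT hz).2, norm_annulusExp_cuffLog]⟩
  · rintro ⟨s, hs, hζ⟩
    have hc' : (L e : ℂ) ≠ 0 := by exact_mod_cast h.ne'
    have hpi : (Real.pi : ℂ) ≠ 0 := by exact_mod_cast Real.pi_ne_zero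
    have hζ0 : ζ ≠ 0 := by
      rintro rfl
      rw [norm_zero] at hζ
      exact (Real.exp_pos _).ne hζ
    -- Any logarithm will do: the modulus of `ζ` fixes `Im X = π/2 - s`, which lies in `(0, π)`, so
    -- `X` is the logarithmic coordinate of a point of `ℍ`.
    obtain ⟨X, rfl⟩ : ∃ X, annulusExp (L e) X = ζ :=
      ⟨L e / (Complex.I * Real.pi) * Complex.log ζ, by
        rw [annulusExp, ← mul_assoc, div_mul_div_cancel₀ hc',
          div_self (mul_ne_zero Complex.I_ne_zero hpi), one_mul, Complex.exp_log hζ0]⟩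
    have hX : X.im = Real.pi / 2 - s := by
      rw [norm_annulusExp, annulusRadius, Real.exp_eq_exp, neg_inj, div_left_inj' h.ne',
        mul_right_inj' Real.pi_ne_zero] at hζ
      exact hζ
    have hs1 := (hT hs).1
    have hs2 := (hC.Ioo_subset (hT hs)).2
    obtain ⟨z, rfl⟩ := exists_cuffLog_eq h (X := X) (by linarith) (by linarith)
    have hz : cuffHeight L e h z = s := by rw [cuffHeight, hX]; ring
    refine ⟨Pants.proj L z, (hC.proj_mem_region_iff hT (by rw [hz]; exact (hT hs).2)).2
      (by rwa [hz]), hC.coord_proj (by rw [hz]; exact (hT hs).2)⟩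

/-- The region, via its coordinate, and `Circle × S`, via polar coordinates with radius
reparametrized by `β`, are embedded in `ℂ` with the same image. -/
theorem nonempty_region_homeomorph {T S : Set ℝ} (hT : T ⊆ Set.Ioo (-(Real.pi / 2)) s₁)
    (β : ℝ ≃ₜ ℝ) (hβ : ∀ y, β y ∈ T ↔ y ∈ S) :
    Nonempty (Pants.region L e T ≃ₜ Circle × S) := by
  have h1 := hC.isEmbedding_domRestrict_coord hT
  have hp : IsEmbedding fun p : Circle × ℝ => ((annulusRadius (L e) (β p.2) : ℝ) : ℂ) * (p.1 : ℂ) :=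
    isEmbedding_polar (fun _ => Real.exp_pos _)
      ((isEmbedding_annulusRadius h).comp β.isEmbedding)
  have hq : IsEmbedding fun p : Circle × S => ((p.1, (p.2 : ℝ)) : Circle × ℝ) :=
    IsEmbedding.id.prodMap IsEmbedding.subtypeVal
  have h2 := hp.comp hq
  have h3 : Set.range ((Pants.region L e T).domRestrict (collarCoord L e h s₁)) =
      Set.range ((fun p : Circle × ℝ => ((annulusRadius (L e) (β p.2) : ℝ) : ℂ) * (p.1 : ℂ)) ∘
        fun p : Circle × S => ((p.1, (p.2 : ℝ)) : Circle × ℝ)) := by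
    rw [Set.range_domRestrict, hC.image_coord hT]
    ext ζ
    constructor
    · rintro ⟨s, hs, hζ⟩
      have hpos : 0 < annulusRadius (L e) s := Real.exp_pos _
      refine ⟨(⟨ζ / annulusRadius (L e) s, ?_⟩, ⟨β.symm s, ?_⟩), ?_⟩
      · simp [Submonoid.unitSphere, hζ, abs_of_pos hpos, hpos.ne']
      · rw [← hβ]; simpa using hs
      · have : (annulusRadius (L e) s : ℂ) ≠ 0 := by exact_mod_cast hpos.ne'
        change ((annulusRadius (L e) (β (β.symm s)) : ℝ) : ℂ) * (ζ / annulusRadius (L e) s) = ζ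
        rw [Homeomorph.apply_symm_apply, mul_div_cancel₀ _ this]
    · rintro ⟨⟨u, y⟩, rfl⟩
      refine ⟨β y, (hβ y).2 y.2, ?_⟩
      have hpos : 0 < annulusRadius (L e) (β y) := Real.exp_pos _
      have hu : ‖(u : ℂ)‖ = 1 := Circle.norm_coe u
      refine (norm_mul _ _).trans ?_
      rw [Complex.norm_real, Real.norm_of_nonneg hpos.le]
      exact (congrArg _ hu).trans (mul_one _)
  exact ⟨h1.toHomeomorph.trans ((Homeomorph.setCongr h3).trans h2.toHomeomorph.symm)⟩

theorem nonempty_region_Ioo_homeomorph {a b : ℝ} (hab : a < b) (ha : -(Real.pi / 2) ≤ a)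
    (hb : b ≤ s₁) :
    Nonempty (Pants.region L e (Set.Ioo a b) ≃ₜ Circle × Set.Ioo (0 : ℝ) 1) := by
  have h0 : 0 < b - a := sub_pos.2 hab
  refine hC.nonempty_region_homeomorph (Set.Ioo_subset_Ioo ha hb)
    (affineHomeomorph (b - a) a h0.ne') fun y => ?_
  simp only [affineHomeomorph_apply, Set.mem_Ioo]
  constructor <;> rintro ⟨h1, h2⟩ <;> constructor <;> nlinarith

theorem nonempty_region_Ioc_homeomorph {a b : ℝ} (hab : a < b) (ha : -(Real.pi / 2) ≤ a)
    (hb : b < s₁) :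
    Nonempty (Pants.region L e (Set.Ioc a b) ≃ₜ Circle × Set.Ico (0 : ℝ) 1) := by
  have h0 : a - b < 0 := sub_neg.2 hab
  refine hC.nonempty_region_homeomorph
    (fun s hs => ⟨ha.trans_lt hs.1, hs.2.trans_lt hb⟩)
    -- The slope is negative so that the closed end `b` corresponds to `0` and the open end `a` to
    -- `1`.
    (affineHomeomorph (a - b) b h0.ne) fun y => ?_
  simp only [affineHomeomorph_apply, Set.mem_Ioc, Set.mem_Ico]
  constructor <;> rintro ⟨h1, h2⟩ <;> constructor <;> nlinarith

/-- Upstairs the region is a union of infinitely many translates, so closedness is not automatic.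
The uniform `δ` shows that a limit point has a lift inside the collar. There the height is well
defined, and points of height above `s₂` have the open region `(s₂, s₁)` as a neighbourhood missing
the set. -/
theorem isClosed_region {s₂ : ℝ} (h2 : s₂ ∈ Set.Ioo (-(Real.pi / 2)) s₁) :
    IsClosed (Pants.region L e (Set.Ioc (-(Real.pi / 2)) s₂)) := by
  have hB : Set.Ioc (-(Real.pi / 2)) s₂ ⊆ Set.Ioo (-(Real.pi / 2)) s₁ :=
    fun s hs => ⟨hs.1, hs.2.trans_lt h2.2⟩
  obtain ⟨δ, hδ, hsep⟩ := exists_dist_lt_imp_cuffHeight_lt h h2.2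
    (by linarith [h2.1, hC.lt])
  refine isClosed_of_closure_subset fun x hx => ?_
  obtain ⟨z, rfl⟩ := Pants.proj_surjective x
  rw [mem_closure_iff_nhds] at hx
  obtain ⟨_, ⟨z', hz', rfl⟩, hB'⟩ := hx (Pants.proj L '' Metric.ball z δ) (by
    rw [← Pants.map_proj_nhds]
    exact image_mem_map (Metric.ball_mem_nhds z hδ))
  obtain ⟨w, hw, hwz⟩ := (_root_.mem_region_iff h (hB.trans hC.Ioo_subset) _).1 hB'
  obtain ⟨γ, hγ, rfl⟩ := (Pants.proj_eq_iff _ _).1 hwz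
  rw [← Pants.proj_smul hγ z] at hx ⊢
  -- `γ` is an isometry, so `γ • z` stays within `δ` of `γ • z'`, whose height is at most `s₂`.
  have hz : cuffHeight L e h (γ • z) < s₁ := by
    refine hsep _ _ ?_ hw.2
    rw [dist_smul, dist_comm]
    exact hz'
  rw [hC.proj_mem_region_iff hB hz]
  refine ⟨(cuffHeight_mem h _).1, ?_⟩
  by_contra! hlt
  obtain ⟨y, hy, hy'⟩ := hx (Pants.region L e (Set.Ioo s₂ s₁)) (by
    have hA : Set.Ioo s₂ s₁ ⊆ Set.Ioo (-(Real.pi / 2)) s₁ := Set.Ioo_subset_Ioo_left h2.1.le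
    exact (_root_.isOpen_region (hA.trans hC.Ioo_subset) isOpen_Ioo h).mem_nhds
      ((hC.proj_mem_region_iff hA hz).2 ⟨hlt, hz⟩))
  refine Set.disjoint_left.1 (hC.disjoint_region (Set.Ioo_subset_Ioo_left h2.1.le) hB ?_) hy hy'
  rw [Set.disjoint_left]
  exact fun s hs hs' => hs'.2.not_gt hs.1

/-- Embeddedness is assumed only below `s₁`. If a translate of `z` had height below `m < s₁`, then
so would that translate of nearby points `v` with height in `(m, s₁)`, contradicting that equivalent
points of the collar have equal heights. -/
theorem proj_notMem_region {z : ℍ} (hz : cuffHeight L e h z = s₁) :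
    Pants.proj L z ∉ Pants.region L e (Set.Ioo (-(Real.pi / 2)) s₁) := by
  rw [hC.mem_region_iff]
  rintro ⟨w, hw, hwz⟩
  obtain ⟨γ, hγ, rfl⟩ := (Pants.proj_eq_iff _ _).1 hwz
  obtain ⟨m, hm1, hm2⟩ := exists_between hw
  have e1 : ∀ᶠ v in 𝓝 z, cuffHeight L e h (γ • v) < m :=
    ((continuous_cuffHeight h).comp (continuous_const_smul γ)).continuousAt.eventually
      (gt_mem_nhds hm1)
  have e2 : ∀ᶠ v in 𝓝 z, m < cuffHeight L e h v :=
    (continuous_cuffHeight h).continuousAt.eventually (lt_mem_nhds (by rwa [hz]))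
  obtain ⟨v, ⟨h1, h2⟩, h3⟩ := mem_closure_iff_nhds.1 (mem_closure_cuffHeight_lt h z) _ (e1.and e2)
  rw [Set.mem_ofPred_eq, hz] at h3
  have h4 := hC.cuffHeight_eq (h1.trans hm2) h3 (Pants.proj_smul hγ _)
  linarith

theorem proj_mem_frontier {z : ℍ} (hz : cuffHeight L e h z = s₁) :
    Pants.proj L z ∈ frontier (Pants.region L e (Set.Ioo (-(Real.pi / 2)) s₁)) := by
  rw [hC.isOpen_region.frontier_eq]
  refine ⟨?_, hC.proj_notMem_region hz⟩
  refine closure_mono ?_ (image_closure_subset_closure_image Pants.continuous_proj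
    (Set.mem_image_of_mem _ (mem_closure_cuffHeight_lt h z)))
  rintro _ ⟨w, hw, rfl⟩
  rw [Set.mem_ofPred_eq, hz] at hw
  exact (hC.mem_region_iff _).2 ⟨w, hw, rfl⟩

/-- Only some translate `γ • z` need lie in the collar, so the coordinate is differentiated as
`annulusExp ∘ cuffLog ∘ γ`. The factor `|ζ| π / c` from the exponential cancels against the density
of `A_c`, leaving `1 / sin (Im X)`, and `cuffLog` and `γ` are isometries. -/
theorem exists_hasDerivAt_coord {z : ℍ}
    (hz : Pants.proj L z ∈ Pants.region L e (Set.Ioo (-(Real.pi / 2)) s₁)) : ∃ d : ℂ,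
    HasDerivAt (fun w => collarCoord L e h s₁ (Pants.projC L w)) d (z : ℂ) ∧
      annulusDensity (L e) (collarCoord L e h s₁ (Pants.proj L z)) * ‖d‖ = 1 / z.im := by
  obtain ⟨w, hw, hwz⟩ := (hC.mem_region_iff _).1 hz
  obtain ⟨γ, hγ, rfl⟩ := (Pants.proj_eq_iff _ _).1 hwz
  have hdet : 0 < (Matrix.SpecialLinearGroup.mapGL ℝ γ).val.det := by
    rw [coe_mapGL, γ.2]; exact one_pos
  obtain ⟨d₁, hd₁, hn₁⟩ := UpperHalfPlane.exists_hasStrictDerivAt_smul hdet z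
  obtain ⟨d₂, hd₂, hn₂⟩ := hasStrictDerivAt_cuffLog h (γ • z)
  have hd₃ := hasStrictDerivAt_annulusExp (L e) (cuffLog L e h (γ • z))
  rw [← sl_smul_eq] at hn₁
  have hγz : ((γ • z : ℍ) : ℂ) =
      (Matrix.SpecialLinearGroup.mapGL ℝ γ • UpperHalfPlane.ofComplex (z : ℂ) : ℍ) := by
    rw [UpperHalfPlane.ofComplex_apply, sl_smul_eq]
  rw [hγz] at hd₂
  have hd₄ := hd₂.hasDerivAt.comp (z : ℂ) hd₁.hasDerivAt
  have hd₅ := HasDerivAt.comp (h₂ := annulusExp (L e)) (z : ℂ)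
    (by simpa [Function.comp_def, ← sl_smul_eq] using hd₃.hasDerivAt) hd₄
  refine ⟨_, hd₅.congr_of_eventuallyEq ?_, ?_⟩
  · have hev : ∀ᶠ w in 𝓝 z, cuffHeight L e h (γ • w) < s₁ :=
      ((continuous_cuffHeight h).comp (continuous_const_smul γ)).continuousAt.eventually
        (gt_mem_nhds hw)
    rw [← UpperHalfPlane.map_ofComplex_nhds] at hev
    filter_upwards [hev] with w hw
    rw [Pants.projC, ← Pants.proj_smul hγ, hC.coord_proj hw]
    simp [← sl_smul_eq]
  · rw [← Pants.proj_smul hγ, hC.coord_proj hw, annulusDensity, norm_annulusExp, Real.log_exp,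
      norm_mul, norm_mul, norm_mul, norm_annulusExp, norm_div, norm_mul, Complex.norm_I,
      Complex.norm_real, Complex.norm_real, Real.norm_of_nonneg Real.pi_pos.le,
      Real.norm_of_nonneg h.le]
    have hpi := Real.pi_ne_zero
    have hc := h.ne'
    have harg : -(L e / Real.pi * -(Real.pi * (cuffLog L e h (γ • z)).im / L e)) =
      (cuffLog L e h (γ • z)).im := by field_simp
    rw [harg, ← hn₂, ← hn₁]
    have hz := z.im_pos.ne'
    have hpos : 0 < Real.sin (cuffLog L e h (γ • z)).im := by
      have hm := cuffHeight_mem h (γ • z)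
      rw [cuffLog_im]
      exact Real.sin_pos_of_pos_of_lt_pi (by linarith [hm.2]) (by linarith [hm.1])
    rw [← hn₂, ← hn₁] at hpos
    have h1 : ‖d₂‖ ≠ 0 := by intro h0; simp [h0] at hpos
    have h2 : ‖d₁‖ ≠ 0 := by intro h0; simp [h0] at hpos
    have h3 := Real.exp_ne_zero (-(Real.pi * (cuffLog L e h (γ • z)).im / L e))
    field_simp

theorem tendsto_norm_coord (h1 : -(Real.pi / 2) < s₁) :
    Tendsto (fun x => ‖collarCoord L e h s₁ x‖) (Pants.endFilter L e)
    (𝓝 (Real.exp (-(Real.pi ^ 2 / L e)))) := by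
  rw [← annulusRadius_neg_half_pi]
  intro N hN
  have hN' : annulusRadius (L e) ⁻¹' N ∈ 𝓝[>] (-(Real.pi / 2)) :=
    mem_nhdsWithin_of_mem_nhds ((continuous_annulusRadius _).continuousAt hN)
  obtain ⟨b, hb, hbN⟩ := mem_nhdsGT_iff_exists_Ioo_subset.1 hN'
  have hs : min b s₁ ∈ Set.Ioo (-(Real.pi / 2)) (Real.pi / 2) :=
    ⟨lt_min hb h1, (min_le_right _ _).trans_lt hC.lt⟩
  refine mem_map.2 (mem_of_superset (region_mem_endFilter hs) fun x hx => ?_)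
  have hT : Set.Ioo (-(Real.pi / 2)) (min b s₁) ⊆ Set.Ioo (-(Real.pi / 2)) s₁ :=
    Set.Ioo_subset_Ioo_right (min_le_right _ _)
  obtain ⟨z, hz, rfl⟩ := (_root_.mem_region_iff h (hT.trans hC.Ioo_subset) x).1 hx
  rw [Set.mem_preimage, hC.coord_proj (hT hz).2, norm_annulusExp_cuffLog]
  exact hbN ⟨hz.1, hz.2.trans_le (min_le_left _ _)⟩

/-- A line `Re = a` in the logarithmic coordinate which is mapped into the collar stays in it. -/
theorem le_of_forall_proj_mem (h1 : -(Real.pi / 2) < s₁) {s a : ℝ}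
    (hs : ∀ z : ℍ, (cuffLog L e h z).re = a → cuffHeight L e h z < s →
      Pants.proj L z ∈ Pants.region L e (Set.Ioo (-(Real.pi / 2)) s₁)) : s ≤ s₁ := by
  by_contra! hlt
  obtain ⟨z, hz⟩ := exists_cuffLog_eq h (X := ⟨a, Real.pi / 2 - s₁⟩) (by simp [hC.lt])
    (by simp only; linarith)
  have hz' : cuffHeight L e h z = s₁ := by rw [cuffHeight, hz]; simp
  exact hC.proj_notMem_region hz' (hs z (by rw [hz]) (by rwa [hz']))

end IsCollar

/-! ### Seams in the logarithmic coordinate, and the plumbing data of a collar. -/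

section

variable {L : Fin 3 → ℝ} {e : Fin 3} (h : 0 < L e)

theorem norm_axisMap_omega_smul (z : ℍ) : ‖((axisMap (L e) h • omega L e • z : ℍ) : ℂ)‖ =
    Real.exp (cuffLog L e h z).re := by
  rw [← mul_smul, ← cuffMap, ← exp_cuffLog h, Complex.norm_exp]

theorem omega_smul_mem_seamOut_iff (z : ℍ) :
    omega L e • z ∈ seamOut ↔ (cuffLog L e h z).re = 0 := by
  rw [mem_seamOut_iff h, norm_axisMap_omega_smul, Real.exp_eq_one_iff]

theorem omega_smul_mem_seamIn_iff (z : ℍ) :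
    omega L e • z ∈ seamIn (L e) ↔ (cuffLog L e h z).re = L e := by
  rw [mem_seamIn_iff h, norm_axisMap_omega_smul, Real.exp_eq_exp]

theorem annulusExp_of_re_eq_zero {c : ℝ} {X : ℂ} (hX : X.re = 0) :
    annulusExp c X = (Real.exp (-(Real.pi * X.im / c)) : ℝ) := by
  rw [annulusExp, Complex.ofReal_exp]
  congr 1
  conv_lhs => rw [← Complex.re_add_im X, hX]
  push_cast
  linear_combination (Real.pi * X.im / c : ℂ) * Complex.I_sq

theorem annulusExp_of_re_eq {c : ℝ} (hc : 0 < c) {X : ℂ} (hX : X.re = c) :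
    annulusExp c X = (-Real.exp (-(Real.pi * X.im / c)) : ℝ) := by
  have hc' : (c : ℂ) ≠ 0 := by exact_mod_cast hc.ne'
  have h1 : annulusExp c X = Complex.exp (Real.pi * Complex.I) * annulusExp c (X - c) := by
    rw [annulusExp, annulusExp, ← Complex.exp_add]
    congr 1
    field_simp
    ring
  rw [h1, Complex.exp_pi_mul_I, annulusExp_of_re_eq_zero (by simp [hX])]
  simp

theorem region_union_region {T T' T'' : Set ℝ} (hT : T ∪ T' = T'') :
    Pants.region L e T ∪ Pants.region L e T' = Pants.region L e T'' := by
  subst hT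
  refine (Set.union_subset (region_mono Set.subset_union_left)
    (region_mono Set.subset_union_right)).antisymm ?_
  rintro x ⟨z, ⟨s, hs | hs, hz⟩, hx⟩
  · exact Or.inl ⟨z, ⟨s, hs, hz⟩, hx⟩
  · exact Or.inr ⟨z, ⟨s, hs, hz⟩, hx⟩

/-- The data of the plumbing construction given by a collar and a hypercycle in it. -/
def collarEnd {s₁ : ℝ} (hC : IsCollar L e h s₁) (s₂ : ℝ)
    (h2 : s₂ ∈ Set.Ioo (-(Real.pi / 2)) s₁) : PlumbingEnd L e where
  U := Pants.region L e (Set.Ioo (-(Real.pi / 2)) s₁)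
  isOpen_U := hC.isOpen_region
  U_mem := region_mem_endFilter ⟨h2.1.trans h2.2, hC.lt⟩
  U_annulus := hC.nonempty_region_Ioo_homeomorph (h2.1.trans h2.2) le_rfl le_rfl
  coord := collarCoord L e h s₁
  mapsTo x hx := by
    obtain ⟨z, hz, rfl⟩ := (hC.mem_region_iff x).1 hx
    rw [hC.coord_proj hz]
    exact annulusExp_cuffLog_mem z
  injOn := hC.injOn_coord
  isometric _ hz := hC.exists_hasDerivAt_coord hz
  tendsto_end := hC.tendsto_norm_coord (h2.1.trans h2.2)
  seam_out s hs hU z hz := by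
    have hT : Set.Ioo (-(Real.pi / 2)) s ⊆ Set.Ioo (-(Real.pi / 2)) (Real.pi / 2) :=
      Set.Ioo_subset_Ioo_right hs.2.le
    -- The segment cannot pass height `s₁` without leaving `U`. Hence `z` itself, and not merely a
    -- translate off the seam, lies in the collar, and its own logarithm computes the coordinate.
    have hle : s ≤ s₁ := hC.le_of_forall_proj_mem (h2.1.trans h2.2) fun w hw hws =>
      hU w ⟨(omega_smul_mem_seamOut_iff h w).2 hw,
        (mem_band_omega_iff h rfl hT w).2 ⟨(cuffHeight_mem h w).1, hws⟩⟩
    have hz2 := (mem_band_omega_iff h rfl hT z).1 hz.2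
    have hre := annulusExp_of_re_eq_zero (c := L e) ((omega_smul_mem_seamOut_iff h z).1 hz.1)
    exact ⟨_, Real.exp_pos _, (hC.coord_proj (hz2.2.trans_le hle)).trans hre⟩
  seam_in s hs hU z hz := by
    have hT : Set.Ioo (-(Real.pi / 2)) s ⊆ Set.Ioo (-(Real.pi / 2)) (Real.pi / 2) :=
      Set.Ioo_subset_Ioo_right hs.2.le
    have hle : s ≤ s₁ := hC.le_of_forall_proj_mem (h2.1.trans h2.2) fun w hw hws =>
      hU w ⟨(omega_smul_mem_seamIn_iff h w).2 hw,
        (mem_band_omega_iff h rfl hT w).2 ⟨(cuffHeight_mem h w).1, hws⟩⟩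
    have hz2 := (mem_band_omega_iff h rfl hT z).1 hz.2
    have hre := annulusExp_of_re_eq h ((omega_smul_mem_seamIn_iff h z).1 hz.1)
    exact ⟨_, (hC.coord_proj (hz2.2.trans_le hle)).trans hre⟩
  A := Pants.region L e (Set.Ioo s₂ s₁)
  B := Pants.region L e (Set.Ioc (-(Real.pi / 2)) s₂)
  isOpen_A := isOpen_region ((Set.Ioo_subset_Ioo_left h2.1.le).trans hC.Ioo_subset) isOpen_Ioo h
  A_annulus := hC.nonempty_region_Ioo_homeomorph h2.2 h2.1.le le_rfl
  A_subset := region_mono (Set.Ioo_subset_Ioo_left h2.1.le)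
  isClosed_B := hC.isClosed_region h2
  B_annulus := hC.nonempty_region_Ioc_homeomorph h2.1 le_rfl h2.2
  B_subset := region_mono fun _ hs => ⟨hs.1, hs.2.trans_lt h2.2⟩
  B_mem := mem_of_superset (region_mem_endFilter ⟨h2.1, h2.2.trans hC.lt⟩)
    (region_mono Set.Ioo_subset_Ioc_self)
  disjoint := hC.disjoint_region (Set.Ioo_subset_Ioo_left h2.1.le)
    (fun _ hs => ⟨hs.1, hs.2.trans_lt h2.2⟩)
    (Set.disjoint_left.2 fun _ hs hs' => hs'.2.not_gt hs.1)
  isOpen_union := by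
    rw [Set.union_comm, region_union_region (Set.Ioc_union_Ioo_eq_Ioo h2.1.le h2.2)]
    exact hC.isOpen_region

end

/-! ### The gluing map in the logarithmic coordinate. -/

/-- In the coordinate `u = (w + r)/(r - w)`, `J` is `u ↦ -1/u` and `T_μ` is `u ↦ e^(-μ) u`. -/
theorem mob_matT_mob_matJ_iff {c : ℝ} (hc : 0 < c) (μ : ℂ) (w w' : ℍ) :
    (w' : ℂ) = mob (matT c μ) (mob (matJ c) w) ↔
      ((axisMap c hc • w' : ℍ) : ℂ) * (axisMap c hc • w : ℍ) = -Complex.exp (-μ) := by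
  have hr : (cothHalf c : ℂ) ≠ 0 := by exact_mod_cast (cothHalf_pos hc).ne'
  have hw := w.ne_zero
  have hw' := w'.ne_zero
  have hd := cothHalf_sub_coe_ne_zero c w
  have hd' := cothHalf_sub_coe_ne_zero c w'
  have hs : (w : ℂ) + cothHalf c ≠ 0 := fun h0 => w.ne_ofReal (-cothHalf c) (by
    push_cast; exact eq_neg_of_add_eq_zero_left h0)
  have hexp := Complex.exp_ne_zero (μ / 2)
  have hcs : Complex.cosh (μ / 2) + Complex.sinh (μ / 2) = Complex.exp (μ / 2) :=
    Complex.cosh_add_sinh _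
  have hcs' : Complex.cosh (μ / 2) - Complex.sinh (μ / 2) = Complex.exp (-(μ / 2)) :=
    Complex.cosh_sub_sinh _
  have hexp2 : Complex.exp (-μ) * Complex.exp (μ / 2) = Complex.exp (-(μ / 2)) := by
    rw [← Complex.exp_add]; congr 1; ring
  rw [coe_axisMap_smul, coe_axisMap_smul]
  simp only [mob, matT, matJ, tanhHalf_eq, Matrix.of_apply, Matrix.cons_val', Matrix.cons_val_zero,
    Matrix.cons_val_one, Matrix.cons_val_fin_one]
  rw [← hcs, ← hcs'] at hexp2
  rw [← hcs] at hexp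
  clear hcs hcs'
  push_cast
  generalize Complex.exp (-μ) = q at *
  generalize Complex.cosh (μ / 2) = ch at *
  generalize Complex.sinh (μ / 2) = sh at *
  generalize (cothHalf c : ℂ) = r at *
  generalize (w : ℂ) = x at *
  generalize (w' : ℂ) = y at *
  have hmob : (ch * ((0 * x + -r) / (r⁻¹ * x + 0)) + -(sh * r)) /
      (-(sh * r⁻¹) * ((0 * x + -r) / (r⁻¹ * x + 0)) + ch) =
      (-ch * r ^ 2 - sh * r * x) / (sh * r + ch * x) := by
    have hJ : (0 * x + -r) / (r⁻¹ * x + 0) = -r ^ 2 / x := by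
      rw [zero_mul, zero_add, add_zero, div_eq_div_iff (mul_ne_zero (inv_ne_zero hr) hw) hw]
      linear_combination x * r * mul_inv_cancel₀ hr
    rw [hJ, ← mul_div_mul_right _ _ hw, add_mul, add_mul, mul_assoc ch, mul_assoc _ _ x,
      div_mul_cancel₀ _ hw]
    congr 1
    · ring
    · linear_combination sh * r * mul_inv_cancel₀ hr
  rw [hmob]
  -- Both sides reduce to this bilinear relation once denominators are cleared.
  trans ch * (y * x + r ^ 2) + sh * r * (y + x) = 0
  · constructor
    · intro h
      -- A zero denominator would give the value `0`, which is not a point of `ℍ`.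
      have hD : sh * r + ch * x ≠ 0 := by
        intro h0
        rw [h0, div_zero] at h
        exact hw' h
      rw [eq_div_iff hD] at h
      linear_combination h
    · intro h
      -- Here a zero denominator, with `x ≠ ±r`, forces `ch = 0` and then `sh = 0`, against `ch + sh
      -- = exp (μ/2)`.
      have hD : sh * r + ch * x ≠ 0 := by
        intro h0
        have h1 : ch * ((x + r) * (r - x)) = 0 := by linear_combination h - (y + x) * h0
        have h2 := (mul_eq_zero.1 h1).resolve_right (mul_ne_zero hs hd)
        rw [h2, zero_mul, add_zero] at h0
        have h3 := (mul_eq_zero.1 h0).resolve_right hr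
        rw [h2, h3, add_zero] at hexp
        exact hexp rfl
      rw [eq_div_iff hD]
      linear_combination h
  · rw [div_mul_div_comm, div_eq_iff (mul_ne_zero hd' hd)]
    constructor <;> intro h
    · refine mul_right_cancel₀ hexp ?_
      linear_combination 2 * h + (r - y) * (r - x) * hexp2
    · linear_combination (1 / 2) * (ch + sh) * h - (1 / 2) * (r - y) * (r - x) * hexp2

/-- The product relation gives `X + X' = iπ - μ` modulo `2πi`. Since `0 < Im X + Im X' < 2π` and `0
< π - Im μ ≤ π`, the imaginary parts differ by less than `2π`, so the relation holds exactly. -/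
theorem log_axisMap_eq_iff {c : ℝ} (hc : 0 < c) {μ : ℂ} (h0 : 0 ≤ μ.im) (hpi : μ.im < Real.pi)
    (w w' : ℍ) : (w' : ℂ) = mob (matT c μ) (mob (matJ c) w) ↔
      Complex.log (axisMap c hc • w' : ℍ) =
        Complex.I * Real.pi - μ - Complex.log (axisMap c hc • w : ℍ) := by
  rw [mob_matT_mob_matJ_iff hc]
  have h1 := arg_coe_mem_Ioo (axisMap c hc • w)
  have h2 := arg_coe_mem_Ioo (axisMap c hc • w')
  have e1 := Complex.exp_log (UpperHalfPlane.ne_zero (axisMap c hc • w))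
  have e2 := Complex.exp_log (UpperHalfPlane.ne_zero (axisMap c hc • w'))
  rw [← Complex.log_im] at h1 h2
  generalize Complex.log (axisMap c hc • w : ℍ) = X at *
  generalize Complex.log (axisMap c hc • w' : ℍ) = X' at *
  rw [← e1, ← e2, ← Complex.exp_add,
    show -Complex.exp (-μ) = Complex.exp (Complex.I * Real.pi - μ) by
      rw [sub_eq_add_neg, Complex.exp_add, mul_comm Complex.I, Complex.exp_pi_mul_I, neg_one_mul],
    Complex.exp_eq_exp_iff_exists_int]
  constructor
  · rintro ⟨n, hn⟩
    have him := congrArg Complex.im hn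
    simp at him
    have hp := Real.pi_pos
    have hn1 : (-1 : ℝ) < n := by
      by_contra! hlt
      nlinarith [h1.1, h2.1]
    have hn2 : (n : ℝ) < 1 := by
      by_contra! hlt
      nlinarith [h1.2, h2.2]
    have hn0 : n = 0 := by
      have : (-1 : ℤ) < n := by exact_mod_cast hn1
      have : n < (1 : ℤ) := by exact_mod_cast hn2
      omega
    rw [hn0] at hn
    push_cast at hn
    linear_combination hn
  · intro h
    exact ⟨0, by rw [h]; push_cast; ring⟩

theorem annulusExp_add (c : ℝ) (X Y : ℂ) :
    annulusExp c (X + Y) = annulusExp c X * annulusExp c Y := by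
  rw [annulusExp, annulusExp, annulusExp, ← Complex.exp_add, mul_add]

theorem annulusExp_sub (c : ℝ) (X Y : ℂ) :
    annulusExp c (X - Y) = annulusExp c X / annulusExp c Y := by
  rw [eq_div_iff (annulusExp_ne_zero _ _), ← annulusExp_add, sub_add_cancel]

/-- The inversion `ζ ↦ a / ζ`. -/
def inversionChart (a : ℂ) (ha : a ≠ 0) : OpenPartialHomeomorph ℂ ℂ where
  toFun ζ := a / ζ
  invFun ζ := a / ζ
  source := {0}ᶜ
  target := {0}ᶜ
  map_source' _ hζ := div_ne_zero ha hζ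
  map_target' _ hζ := div_ne_zero ha hζ
  left_inv' _ _ := div_div_cancel₀ ha
  right_inv' _ _ := div_div_cancel₀ ha
  open_source := isOpen_compl_singleton
  open_target := isOpen_compl_singleton
  continuousOn_toFun := continuousOn_const.div continuousOn_id fun _ hζ => hζ
  continuousOn_invFun := continuousOn_const.div continuousOn_id fun _ hζ => hζ

/-! ### The plumbing map between two collars. -/

namespace IsCollar

section

variable {L L' : Fin 3 → ℝ} {e e' : Fin 3} {h : 0 < L e} {h' : 0 < L' e'} {s₁ s₁' s₂ : ℝ}
  (hC : IsCollar L e h s₁) (hC' : IsCollar L' e' h' s₁') {c : ℝ} (hc : L e = c) (hc' : L' e' = c)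
  {μ : ℂ}

include hC in
theorem annulusExp_div_coord_proj (hc : L e = c) {z : ℍ} (hz : cuffHeight L e h z < s₁) :
    annulusExp c (Complex.I * Real.pi - μ) / collarCoord L e h s₁ (Pants.proj L z) =
      annulusExp c (Complex.I * Real.pi - μ - cuffLog L e h z) := by
  rw [hC.coord_proj hz, hc]
  exact (annulusExp_sub _ _ _).symm

include hC hC' hc hc' in
-- Inversion sends height `s` to height `Im μ - s`, and `Im μ - s < s₁'` means `s > s₂`. The other
-- bound `Im μ - s > -π/2` is automatic from `Im μ ≥ 0` and `s < π/2`.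
theorem annulusExp_div_coord_mem_target_iff (h0 : 0 ≤ μ.im)
    (h2 : -(Real.pi / 2) < s₂) (hs : s₂ + s₁' = μ.im) {x : Pants L}
    (hx : x ∈ Pants.region L e (Set.Ioo (-(Real.pi / 2)) s₁)) :
    annulusExp c (Complex.I * Real.pi - μ) / collarCoord L e h s₁ x ∈ hC'.chart.target ↔
      x ∈ Pants.region L e (Set.Ioo s₂ s₁) := by
  obtain ⟨z, hz, rfl⟩ := (hC.mem_region_iff x).1 hx
  have htarget : hC'.chart.target =
      collarCoord L' e' h' s₁' '' Pants.region L' e' (Set.Ioo (-(Real.pi / 2)) s₁') := rfl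
  rw [htarget, hC'.image_coord subset_rfl, hC.annulusExp_div_coord_proj hc hz,
    hC.proj_mem_region_iff (Set.Ioo_subset_Ioo_left h2.le) hz, Set.mem_ofPred_eq, norm_annulusExp,
    hc']
  have hr : Real.exp (-(Real.pi * (Complex.I * Real.pi - μ - cuffLog L e h z).im / c)) =
      annulusRadius c (μ.im - cuffHeight L e h z) := by
    rw [annulusRadius]
    simp only [Complex.sub_im, cuffLog_im, Complex.mul_im, Complex.I_re, Complex.I_im,
      Complex.ofReal_re, Complex.ofReal_im]
    congr 3
    ring
  have hz' := cuffHeight_mem h z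
  rw [hr]
  constructor
  · rintro ⟨s, hs', hs''⟩
    have := (annulusRadius_strictMono (hc ▸ h)).injective hs''
    exact ⟨by linarith [hs'.2], hz⟩
  · intro hzs
    exact ⟨_, ⟨by linarith [hz'.2], by linarith [hzs.1]⟩, rfl⟩

/-- The map between the overlapping annuli of two collars given by `ẑ(x) ẑ'(f x) = exp (iπt)`. -/
def plumbingMap (c : ℝ) (μ : ℂ) : OpenPartialHomeomorph (Pants L) (Pants L') :=
  (hC.chart.trans (inversionChart (annulusExp c (Complex.I * Real.pi - μ))
    (annulusExp_ne_zero _ _))).trans hC'.chart.symm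

theorem plumbingMap_apply (x : Pants L) : hC.plumbingMap hC' c μ x =
    hC'.chart.symm (annulusExp c (Complex.I * Real.pi - μ) / collarCoord L e h s₁ x) := rfl

include hC in
theorem coord_ne_zero {x : Pants L} (hx : x ∈ Pants.region L e (Set.Ioo (-(Real.pi / 2)) s₁)) :
    collarCoord L e h s₁ x ≠ 0 := by
  obtain ⟨z, hz, rfl⟩ := (hC.mem_region_iff x).1 hx
  rw [hC.coord_proj hz]
  exact annulusExp_ne_zero _ _

include hC hC' hc hc' in
theorem plumbingMap_source (h0 : 0 ≤ μ.im) (h2 : -(Real.pi / 2) < s₂) (hs : s₂ + s₁' = μ.im) :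
    (hC.plumbingMap hC' c μ).source = Pants.region L e (Set.Ioo s₂ s₁) := by
  ext x
  have hsource : x ∈ (hC.plumbingMap hC' c μ).source ↔
      (x ∈ Pants.region L e (Set.Ioo (-(Real.pi / 2)) s₁) ∧ collarCoord L e h s₁ x ≠ 0) ∧
      annulusExp c (Complex.I * Real.pi - μ) / collarCoord L e h s₁ x ∈ hC'.chart.target := by
    rw [plumbingMap, OpenPartialHomeomorph.trans_source, OpenPartialHomeomorph.trans_source]
    rfl
  rw [hsource]
  constructor
  · rintro ⟨⟨hx, -⟩, hx'⟩
    exact (hC.annulusExp_div_coord_mem_target_iff hC' hc hc' h0 h2 hs hx).1 hx'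
  · intro hx
    have hxU := region_mono (Set.Ioo_subset_Ioo_left h2.le) hx
    exact ⟨⟨hxU, hC.coord_ne_zero hxU⟩,
      (hC.annulusExp_div_coord_mem_target_iff hC' hc hc' h0 h2 hs hxU).2 hx⟩

/-- `ζ ↦ a/ζ` is an involution, so inverting the map merely exchanges the two collars; the target is
thus read off from `plumbingMap_source`. -/
theorem plumbingMap_symm :
    (hC.plumbingMap hC' c μ).symm.toPartialEquiv = (hC'.plumbingMap hC c μ).toPartialEquiv := by
  rw [plumbingMap, plumbingMap, OpenPartialHomeomorph.trans_symm_eq_symm_trans_symm,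
    OpenPartialHomeomorph.trans_symm_eq_symm_trans_symm, OpenPartialHomeomorph.symm_symm,
    ← OpenPartialHomeomorph.trans_assoc]
  rfl

include hC hC' hc hc' in
theorem plumbingMap_target {s₂' : ℝ} (h0 : 0 ≤ μ.im) (h2 : -(Real.pi / 2) < s₂')
    (hs : s₂' + s₁ = μ.im) :
    (hC.plumbingMap hC' c μ).target = Pants.region L' e' (Set.Ioo s₂' s₁') := by
  rw [← hC'.plumbingMap_source hC hc' hc h0 h2 hs]
  exact congrArg PartialEquiv.source (hC.plumbingMap_symm hC')

include hC hC' hc hc' in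
-- The explicit lift `X ↦ iπ - μ - X`, from which both holomorphy and the boundary behaviour are
-- read.
theorem plumbingMap_proj (h0 : 0 ≤ μ.im) (hs : s₂ + s₁' = μ.im) {z : ℍ}
    (hz : cuffHeight L e h z ∈ Set.Ioo s₂ s₁) :
    hC.plumbingMap hC' c μ (Pants.proj L z) =
      Pants.proj L' (cuffExp L' e' h' (Complex.I * Real.pi - μ - cuffLog L e h z)) := by
  have hm := cuffHeight_mem h z
  have him : (Complex.I * Real.pi - μ - cuffLog L e h z).im =
      Real.pi / 2 - (μ.im - cuffHeight L e h z) := by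
    simp [cuffLog_im]; ring
  have hlog := cuffLog_cuffExp h' (X := Complex.I * Real.pi - μ - cuffLog L e h z)
    (by rw [him]; linarith [hz.1, hC'.lt]) (by rw [him]; linarith [hm.2])
  have hh : cuffHeight L' e' h' (cuffExp L' e' h' (Complex.I * Real.pi - μ - cuffLog L e h z)) <
      s₁' := by
    rw [cuffHeight, hlog, him]; linarith [hz.1]
  rw [plumbingMap_apply, hC.annulusExp_div_coord_proj hc hz.2]
  have h1 : annulusExp c (Complex.I * Real.pi - μ - cuffLog L e h z) =
      hC'.chart (Pants.proj L' (cuffExp L' e' h'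
        (Complex.I * Real.pi - μ - cuffLog L e h z))) := by
    rw [coe_chart, hC'.coord_proj hh, hlog, hc']
  rw [h1]
  exact hC'.chart.left_inv ((hC'.mem_region_iff _).2 ⟨_, hh, rfl⟩)

include hC hC' hc hc' in
theorem holomorphicPants_plumbingMap (h0 : 0 ≤ μ.im) (h2 : -(Real.pi / 2) < s₂)
    (hs : s₂ + s₁' = μ.im) : HolomorphicPants (hC.plumbingMap hC' c μ) := by
  intro z hz
  rw [hC.plumbingMap_source hC' hc hc' h0 h2 hs, _root_.mem_region_iff h
    ((Set.Ioo_subset_Ioo_left h2.le).trans hC.Ioo_subset)] at hz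
  obtain ⟨w, hw, hwz⟩ := hz
  obtain ⟨γ, hγ, rfl⟩ := (Pants.proj_eq_iff _ _).1 hwz
  have hdet : 0 < (Matrix.SpecialLinearGroup.mapGL ℝ γ).val.det := by
    rw [coe_mapGL, γ.2]; exact one_pos
  refine ⟨fun v => cuffExp L' e' h' (Complex.I * Real.pi - μ -
    cuffLog L e h (γ • UpperHalfPlane.ofComplex v)), ?_⟩
  have hev : ∀ᶠ v in 𝓝 z, cuffHeight L e h (γ • v) ∈ Set.Ioo s₂ s₁ :=
    ((continuous_cuffHeight h).comp (continuous_const_smul γ)).continuousAt.eventually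
      (isOpen_Ioo.mem_nhds hw)
  rw [← UpperHalfPlane.isOpenEmbedding_coe.map_nhds_eq, eventually_map]
  filter_upwards [hev] with v hv
  refine ⟨?_, UpperHalfPlane.im_pos _, ?_⟩
  · have hm := cuffHeight_mem h (γ • v)
    obtain ⟨d₁, hd₁, -⟩ := UpperHalfPlane.exists_hasStrictDerivAt_smul hdet v
    obtain ⟨d₂, hd₂, -⟩ := hasStrictDerivAt_cuffLog h (γ • v)
    have hγv : ((γ • v : ℍ) : ℂ) =
        (Matrix.SpecialLinearGroup.mapGL ℝ γ • UpperHalfPlane.ofComplex (v : ℂ) : ℍ) := by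
      rw [UpperHalfPlane.ofComplex_apply, sl_smul_eq]
    rw [hγv] at hd₂
    have hd₃ := (hd₂.hasDerivAt.comp (v : ℂ) hd₁.hasDerivAt).differentiableAt
    have hd₄ : DifferentiableAt ℂ (fun v : ℂ => Complex.I * Real.pi - μ -
        cuffLog L e h (γ • UpperHalfPlane.ofComplex v)) v := by
      refine DifferentiableAt.sub (differentiableAt_const _) ?_
      simpa [Function.comp_def, sl_smul_eq] using hd₃
    have him : (Complex.I * Real.pi - μ -
        cuffLog L e h (γ • UpperHalfPlane.ofComplex (v : ℂ))).im =
        Real.pi / 2 - (μ.im - cuffHeight L e h (γ • v)) := by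
      simp [cuffLog_im]; ring
    exact (differentiableAt_cuffExp h' (by rw [him]; linarith [hv.1, hC'.lt])
      (by rw [him]; linarith [hm.2])).comp (v : ℂ) hd₄
  · rw [Pants.projC_coe, Pants.projC_coe, ← Pants.proj_smul hγ,
      hC.plumbingMap_proj hC' hc hc' h0 hs hv, UpperHalfPlane.ofComplex_apply]

theorem proj_cuffExp_add {X : ℂ} (h0 : 0 < X.im) (hpi : X.im < Real.pi) (n : ℤ) :
    Pants.proj L (cuffExp L e h (X + n * (2 * L e))) = Pants.proj L (cuffExp L e h X) := by
  have him : (X + n * (2 * L e)).im = X.im := by simp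
  apply exists_deck_of_cuffLog_eq (h := h) (n := n)
  rw [cuffLog_cuffExp h h0 hpi, cuffLog_cuffExp h (by rwa [him]) (by rwa [him])]

include hC in
/-- A neighbourhood of the frontier of a collar contains a thinner collar of the frontier. -/
theorem eventually_proj_cuffExp_mem (h1 : -(Real.pi / 2) < s₁) {O : Set (Pants L)}
    (hO : O ∈ 𝓝ˢ (frontier (Pants.region L e (Set.Ioo (-(Real.pi / 2)) s₁)))) :
    ∀ᶠ s in 𝓝 s₁, ∀ z, cuffHeight L e h z = s → Pants.proj L z ∈ O := by
  -- Modulo the deck group a hypercycle is covered by the compact interval `[0, 2 * L e]` of real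
  -- parts, so a pointwise neighbourhood of the frontier is uniform in `x`.
  have hcomp : ∀ᶠ s in 𝓝 s₁, ∀ x ∈ Set.Icc 0 (2 * L e),
      Pants.proj L (cuffExp L e h ⟨x, Real.pi / 2 - s⟩) ∈ O := by
    refine isCompact_Icc.eventually_forall_of_forall_eventually fun x _ => ?_
    have hlog := cuffLog_cuffExp h (X := ⟨x, Real.pi / 2 - s₁⟩) (by simp [hC.lt])
      (by simp only; linarith)
    have hmem := hC.proj_mem_frontier (z := cuffExp L e h ⟨x, Real.pi / 2 - s₁⟩) (by
      rw [cuffHeight, hlog]; simp)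
    have hcont : ContinuousAt (fun p : ℝ × ℝ =>
        Pants.proj L (cuffExp L e h ⟨p.2, Real.pi / 2 - p.1⟩)) (s₁, x) := by
      have hk : Continuous fun p : ℝ × ℝ => (⟨p.2, Real.pi / 2 - p.1⟩ : ℂ) := by
        have : (fun p : ℝ × ℝ => (⟨p.2, Real.pi / 2 - p.1⟩ : ℂ)) =
            fun p : ℝ × ℝ => (p.2 : ℂ) + ((Real.pi / 2 - p.1 : ℝ) : ℂ) * Complex.I := by
          funext p
          apply Complex.ext <;> simp
        rw [this]
        fun_prop
      have hk' : ContinuousAt (cuffExp L e h) ((⟨x, Real.pi / 2 - s₁⟩ : ℂ)) :=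
        continuousAt_cuffExp h (by simp [hC.lt]) (by simp only; linarith)
      have hk₂ := ContinuousAt.comp (f := fun p : ℝ × ℝ => (⟨p.2, Real.pi / 2 - p.1⟩ : ℂ))
        (x := (s₁, x)) hk' hk.continuousAt
      exact Pants.continuous_proj.continuousAt.comp hk₂
    exact hcont.eventually (mem_nhdsSet_iff_forall.1 hO _ hmem)
  filter_upwards [hcomp] with s hs z hz
  obtain ⟨n, hn, -⟩ := existsUnique_add_zsmul_mem_Ico (show 0 < 2 * L e by linarith)
    (cuffLog L e h z).re 0
  have hm := cuffHeight_mem h z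
  have him := cuffLog_im h z
  have hX := hs _ ⟨hn.1, by linarith [hn.2]⟩
  have hXeq : (⟨(cuffLog L e h z).re + n • (2 * L e), Real.pi / 2 - s⟩ : ℂ) =
      cuffLog L e h z + n * (2 * L e) := by
    apply Complex.ext
    · simp
    · simp [him, hz]
  rw [hXeq, proj_cuffExp_add (by linarith [hm.2]) (by linarith [hm.1]), cuffExp_cuffLog] at hX
  exact hX

end

theorem plumbable {L L' : Fin 3 → ℝ} {e e' : Fin 3} {h : 0 < L e} {h' : 0 < L' e'}
    {s₁ s₁' s₂ s₂' : ℝ} (hC : IsCollar L e h s₁) (hC' : IsCollar L' e' h' s₁')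
    (h2 : s₂ ∈ Set.Ioo (-(Real.pi / 2)) s₁) (h2' : s₂' ∈ Set.Ioo (-(Real.pi / 2)) s₁')
    {c : ℝ} (hc : L e = c) (hc' : L' e' = c) {μ : ℂ} (h0 : 0 ≤ μ.im) (hs : s₂ + s₁' = μ.im)
    (hs' : s₂' + s₁ = μ.im) :
    Plumbable (collarEnd h hC s₂ h2) (collarEnd h' hC' s₂' h2')
      ((Complex.I * Real.pi - μ) / c) := by
  have hsource := hC.plumbingMap_source hC' hc hc' h0 h2.1 hs
  refine ⟨hC.plumbingMap hC' c μ, hsource, hC.plumbingMap_target hC' hc hc' h0 h2'.1 hs',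
    hC.holomorphicPants_plumbingMap hC' hc hc' h0 h2.1 hs, ?_, ?_⟩
  · have hU : (collarEnd h' hC' s₂' h2').A ∪ (collarEnd h' hC' s₂' h2').B =
        Pants.region L' e' (Set.Ioo (-(Real.pi / 2)) s₁') := by
      rw [Set.union_comm]
      exact region_union_region (Set.Ioc_union_Ioo_eq_Ioo h2'.1.le h2'.2)
    rw [hU]
    intro O hO
    obtain ⟨ε, hε, hεO⟩ := Metric.eventually_nhds_iff.1
      (hC'.eventually_proj_cuffExp_mem (h2'.1.trans h2'.2) hO)
    -- Heights in `(s₂, s₂ + ε)` are sent to `(s₁' - ε, s₁')`, because `s₂ + s₁' = Im μ`; the bound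
    -- by `s₁` keeps the neighbourhood inside the collar.
    set b := min (s₂ + ε) s₁ with hb
    have hb1 : s₂ < b := lt_min (by linarith) h2.2
    have hbT : Set.Ioo (-(Real.pi / 2)) b ⊆ Set.Ioo (-(Real.pi / 2)) s₁ :=
      Set.Ioo_subset_Ioo_right (min_le_right _ _)
    have hV : Pants.region L e (Set.Ioo (-(Real.pi / 2)) b) ∈
        𝓝ˢ (frontier (collarEnd h hC s₂ h2).B) := by
      refine (IsOpen.mem_nhdsSet (_root_.isOpen_region (hbT.trans hC.Ioo_subset) isOpen_Ioo h)).2 ?_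
      exact (collarEnd h hC s₂ h2).isClosed_B.frontier_subset.trans
        (region_mono fun s hs => ⟨hs.1, hs.2.trans_lt hb1⟩)
    refine mem_map.2 (mem_inf_of_inter hV (mem_principal_self _) ?_)
    rintro x ⟨hxV, hxA⟩
    obtain ⟨z, hz, rfl⟩ := (_root_.mem_region_iff h (hbT.trans hC.Ioo_subset) x).1 hxV
    have hzA := (hC.proj_mem_region_iff (Set.Ioo_subset_Ioo_left h2.1.le) (hbT hz).2).1 hxA
    have hm := cuffHeight_mem h z
    rw [Set.mem_preimage, hC.plumbingMap_proj hC' hc hc' h0 hs hzA]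
    have him : (Complex.I * Real.pi - μ - cuffLog L e h z).im =
        Real.pi / 2 - (μ.im - cuffHeight L e h z) := by
      simp [cuffLog_im]; ring
    refine hεO (y := μ.im - cuffHeight L e h z) ?_ _ ?_
    · rw [Real.dist_eq, abs_lt]
      have := hz.2.trans_le (min_le_left _ _)
      constructor <;> linarith [hzA.1]
    · rw [cuffHeight, cuffLog_cuffExp h' (by rw [him]; linarith [hzA.1, hC'.lt])
        (by rw [him]; linarith [hm.2]), him]
      ring
  · intro x hx
    have hx' : x ∈ (hC.plumbingMap hC' c μ).source := by rw [hsource]; exact hx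
    have hxU := (collarEnd h hC s₂ h2).A_subset hx
    have ht := (hC.annulusExp_div_coord_mem_target_iff hC' hc hc' h0 h2.1 hs hxU).2 hx
    have h1 := hC'.chart.right_inv ht
    refine (congrArg (collarCoord L e h s₁ x * ·) h1).trans ?_
    rw [mul_div_cancel₀ _ (hC.coord_ne_zero hxU), annulusExp]
    congr 1
    ring

end IsCollar


/-! ### Matching the gluing data with the plumbing data. -/

namespace PantsDecomposition

variable {k ξ : ℕ} (D : PantsDecomposition k ξ) {c : Fin ξ → ℝ} (hc : ∀ i, 0 < c i)
  {μ : Fin ξ → ℂ} {ν : Fin ξ × Bool → ℝ}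

theorem sideLengths_label (c : Fin ξ → ℝ) (p : Fin ξ × Bool) :
    D.sideLengths c p (D.label p) = c p.1 :=
  D.side_injective.extend_apply (fun p => c p.1) (fun _ => 0) p

theorem incl_mono {p : Fin ξ × Bool} {X Y : Set (Pants (D.sideLengths c p))} (h : X ⊆ Y) :
    D.incl c p X ⊆ D.incl c p Y :=
  Set.image_mono h

include hc in
theorem sideLengths_label_pos (p : Fin ξ × Bool) : 0 < D.sideLengths c p (D.label p) := by
  rw [sideLengths_label]; exact hc _

variable {D}

theorem Admissible.isCollar (hν : D.Admissible c μ ν) (p : Fin ξ × Bool) :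
    IsCollar (D.sideLengths c p) (D.label p) (D.sideLengths_label_pos hc p)
      ((μ p.1).im / 2 + ν p) where
  lt := hν.width_lt p
  embedded z w hz hw hzw := by
    have hT : collar μ ν p ⊆ Set.Ioo (-(Real.pi / 2)) (Real.pi / 2) :=
      Set.Ioo_subset_Ioo_right (hν.width_lt p).le
    have hmem : ∀ v, cuffHeight _ _ (D.sideLengths_label_pos hc p) v < (μ p.1).im / 2 + ν p →
        omega (D.sideLengths c p) (D.label p) • v ∈ band (c p.1) (collar μ ν p) := fun v hv =>
      (mem_band_omega_iff _ (D.sideLengths_label c p) hT v).2 ⟨(cuffHeight_mem _ v).1, hv⟩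
    obtain ⟨n, hn⟩ := hν.embedded p z w (hmem z hz) (hmem w hw) hzw
    exact ⟨n, cuffLog_eq_of_omega_smul_eq _ hn⟩

/-- The width bound on the opposite side gives `Im μ / 2 - ν* > Im μ - π/2 ≥ -π/2`. -/
theorem Admissible.inner_mem (hν : D.Admissible c μ ν) (hμ : ∀ i, 0 ≤ (μ i).im)
    (p : Fin ξ × Bool) : (μ p.1).im / 2 - ν (p.1, !p.2) ∈
      Set.Ioo (-(Real.pi / 2)) ((μ p.1).im / 2 + ν p) := by
  have h1 := hν.width_pos p
  have h2 := hν.width_pos (p.1, !p.2)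
  have h3 := hν.width_lt (p.1, !p.2)
  have h4 := hμ p.1
  constructor <;> simp only at * <;> linarith

/-- The data of the plumbing construction which reproduces the gluing construction. -/
def Admissible.plumbingEnd (hν : D.Admissible c μ ν) (hμ : ∀ i, 0 ≤ (μ i).im)
    (p : Fin ξ × Bool) : PlumbingEnd (D.sideLengths c p) (D.label p) :=
  collarEnd (D.sideLengths_label_pos hc p) (hν.isCollar hc p) _ (hν.inner_mem hμ p)

/-- Gluing is the equation `X' = iπ - μ - X` for some lifts; plumbing is the same equation modulo
`2c`, and changing one lift by a deck transformation makes it exact. Plumbing only asks for points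
of `U` and `U'`, but their heights add up to `Im μ`, so the upper bound on each side yields the
lower bound on the other and both points lie in the strips. -/
theorem Admissible.gluingRel_iff (hν : D.Admissible c μ ν)
    (hμ : ∀ i, 0 ≤ (μ i).im ∧ (μ i).im < Real.pi) (x y : D.AllPants c) :
    D.GluingRel c μ ν x y ↔ D.PlumbingRel c (hν.plumbingEnd hc fun i => (hμ i).1)
      (fun i => (Complex.I * Real.pi - μ i) / c i) x y := by
  refine exists_congr fun i => ?_
  have hL := D.sideLengths_label c (i, false)
  have hL' := D.sideLengths_label c (i, true)
  have hC := hν.isCollar hc (i, false)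
  have hC' := hν.isCollar hc (i, true)
  have hin := hν.inner_mem (fun i => (hμ i).1) (i, false)
  have hin' := hν.inner_mem (fun i => (hμ i).1) (i, true)
  set h := D.sideLengths_label_pos hc (i, false)
  set h' := D.sideLengths_label_pos hc (i, true)
  have hT : strip μ ν (i, false) ⊆ Set.Ioo (-(Real.pi / 2)) (Real.pi / 2) :=
    (Set.Ioo_subset_Ioo_left hin.1.le).trans hC.Ioo_subset
  have hT' : strip μ ν (i, true) ⊆ Set.Ioo (-(Real.pi / 2)) (Real.pi / 2) :=
    (Set.Ioo_subset_Ioo_left hin'.1.le).trans hC'.Ioo_subset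
  have hglue : ∀ z z' : ℍ,
      ((omega (D.sideLengths c (i, true)) (D.label (i, true)) • z' : ℍ) : ℂ) =
        mob (matT (c i) (μ i)) (mob (matJ (c i))
        ((omega (D.sideLengths c (i, false)) (D.label (i, false)) • z : ℍ) : ℂ)) ↔
      cuffLog _ _ h' z' = Complex.I * Real.pi - μ i - cuffLog _ _ h z := fun z z' => by
    rw [log_axisMap_eq_iff (hc i) (hμ i).1 (hμ i).2, cuffLog_eq, cuffLog_eq]
    simp only [hL, hL']
  have hexp : Complex.exp (Complex.I * Real.pi * ((Complex.I * Real.pi - μ i) / c i)) =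
      annulusExp (c i) (Complex.I * Real.pi - μ i) := by
    rw [annulusExp]; congr 1; ring
  have hcoord : ∀ z z' : ℍ, cuffHeight _ _ h z < (μ i).im / 2 + ν (i, false) →
      cuffHeight _ _ h' z' < (μ i).im / 2 + ν (i, true) →
      ((hν.plumbingEnd hc fun i => (hμ i).1) (i, false)).coord (Pants.proj _ z) *
        ((hν.plumbingEnd hc fun i => (hμ i).1) (i, true)).coord (Pants.proj _ z') =
      annulusExp (c i) (cuffLog _ _ h z + cuffLog _ _ h' z') := fun z z' hz hz' => by
    have e1 := hC.coord_proj hz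
    have e2 := hC'.coord_proj hz'
    rw [annulusExp_add]
    rw [hL] at e1
    rw [hL'] at e2
    rw [← e1, ← e2]
    rfl
  constructor
  · rintro ⟨z, z', rfl, rfl, hz, hz', hzz'⟩
    rw [mem_band_omega_iff h hL hT] at hz
    rw [mem_band_omega_iff h' hL' hT'] at hz'
    refine ⟨_, (hC.mem_region_iff _).2 ⟨z, hz.2, rfl⟩, _, (hC'.mem_region_iff _).2 ⟨z', hz'.2, rfl⟩,
      rfl, rfl, ?_⟩
    rw [hcoord z z' hz.2 hz'.2, hexp, (hglue z z').1 hzz']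
    congr 1
    ring
  · rintro ⟨x', hx', y', hy', rfl, rfl, hxy⟩
    obtain ⟨z, hz, rfl⟩ := (hC.mem_region_iff _).1 hx'
    obtain ⟨w, hw, rfl⟩ := (hC'.mem_region_iff _).1 hy'
    rw [hcoord z w hz hw, hexp, annulusExp_eq_iff (hc i)] at hxy
    obtain ⟨n, hn⟩ := hxy
    -- Moving the second lift by `-n` periods turns the congruence modulo `2c` into an equality.
    obtain ⟨γ, hγ, hγw⟩ := exists_deck h' (-n)
    have hlog : cuffLog _ _ h' (γ • w) = Complex.I * Real.pi - μ i - cuffLog _ _ h z := by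
      rw [hγw, hL']
      push_cast
      linear_combination hn
    have hheight : cuffHeight _ _ h' (γ • w) = (μ i).im - cuffHeight _ _ h z := by
      rw [cuffHeight, hlog, cuffHeight]
      simp
      ring
    have hw' : cuffHeight _ _ h' (γ • w) < (μ i).im / 2 + ν (i, true) := by
      rwa [cuffHeight_eq_of_cuffLog_eq (hγw w)]
    refine ⟨z, γ • w, rfl, by rw [Pants.proj_smul hγ], ?_, ?_, (hglue _ _).2 hlog⟩
    · rw [mem_band_omega_iff h hL hT]
      exact ⟨by simp only [Bool.not_false]; linarith, hz⟩
    · rw [mem_band_omega_iff h' hL' hT']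
      exact ⟨by simp only [Bool.not_true]; linarith, hw'⟩

end PantsDecomposition

end

theorem proposition3p2 {k ξ : ℕ} (D : PantsDecomposition k ξ)
    (c : Fin ξ → ℝ) (hc : ∀ i, 0 < c i)
    (μ : Fin ξ → ℂ) (hμ : ∀ i, 0 ≤ (μ i).im ∧ (μ i).im < Real.pi)
    (ν : Fin ξ × Bool → ℝ) (hν : D.Admissible c μ ν)
    (t : Fin ξ → ℂ) (ht : ∀ i, t i = (Complex.I * Real.pi - μ i) / c i) :
    (∀ i, 0 < (t i).im) ∧
      D.IsPlumbing c t (D.gluingTrunc c μ ν) (D.gluingSetoid c μ ν) := by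
  obtain rfl : t = fun i => (Complex.I * Real.pi - μ i) / c i := funext ht
  -- The truncated surfaces agree by definition, hence `rfl`: each `B` is the region with the
  -- parameters `cutOff`.
  refine ⟨fun i => ?_, hν.plumbingEnd hc fun i => (hμ i).1, fun p q hpq => ?_, fun i => ?_, rfl, ?_⟩
  · rw [Complex.div_ofReal_im]
    refine div_pos ?_ (hc i)
    simpa using (hμ i).2
  · have hsub : ∀ p, (hν.plumbingEnd hc (fun i => (hμ i).1) p).A ∪
        (hν.plumbingEnd hc (fun i => (hμ i).1) p).B ⊆ Pants.region (D.sideLengths c p) (D.label p)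
          (PantsDecomposition.collar μ ν p) := fun p =>
      Set.union_subset (hν.plumbingEnd hc (fun i => (hμ i).1) p).A_subset
        (hν.plumbingEnd hc (fun i => (hμ i).1) p).B_subset
    exact (hν.disjoint p q hpq).mono (D.incl_mono (hsub p)) (D.incl_mono (hsub q))
  · refine (hν.isCollar hc (i, false)).plumbable (hν.isCollar hc (i, true)) _ _
      (D.sideLengths_label c (i, false)) (D.sideLengths_label c (i, true)) (hμ i).1 ?_ ?_
    -- The inner parameter on one side and the outer one on the other are `Im μ / 2 ∓ ν` with the
    -- same `ν`, so they add up to `Im μ`.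
    · simp
    · simp
  · rw [PantsDecomposition.gluingSetoid]
    congr 1
    funext x y
    exact propext (hν.gluingRel_iff hc hμ x.1 y.1)
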